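/- **Conventions.** Graphs may have loops and multiple edges; each geometric edge is a pair of oppositely oriented edges $e,\bar e$ with $\bar e\ne e$. Let $X$ be a finite graph and let $Y\to X$ be a regular $\mathbb{Z}$-covering, i.e. $\mathbb{Z}=\langle t\rangle$ acts on the graph $Y$ by automorphisms, freely, and $X=Y/\mathbb{Z}$. Let $\chi(X)$ be the number of vertices minus the number of geometric edges of $X$. A free homotopy class of closed edge paths in $Y$ is *primitive* if it is not the class of $p^k$ for any closed path $p$ and $k\ge 2$ (so the class of a constant path is not primitive). Let $\mathcal P$ be the set of primitive free homotopy classes of closed paths in $Y$; for $\gamma\in\mathcal P$ let $\operatorname{len}(\gamma)$ be the length of a shortest representative and $\mathbb{Z}_\gamma$ the stabilizer of $\gamma$ in $\mathbb{Z}$. The $L^2$ zeta function of $Y$ is defined by $$Z_Y^{(2)}(u)^{-1}=\prod_{\gamma\in\mathbb{Z}\backslash\mathcal P}\bigl(1-u^{\operatorname{len}(\gamma)}\bigr)^{1/|\mathbb{Z}_\gamma|}.$$ Choose one vertex $s_a$ of $Y$ over each vertex $a$ of $X$. Let $\delta$ be the matrix over $\mathbb{Z}[t,t^{-1}]$, indexed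 by the vertices of $X$, in which the coefficient of $t^k$ in the entry $(a,b)$ is the number of oriented edges of $Y$ from $s_a$ to $t^k s_b$ (the adjacency operator of $Y$); let $Q$ be the diagonal matrix with entries $\deg(s_a)-1$, and put $\Delta_u=I-u\delta+u^2Q$ for $u\in\mathbb{C}$. **Theorem.** There is a unique polynomial $P\in\mathbb{Z}[u][x]$, written $P_u(x)$, such that for all $u\in\mathbb{C}$ $$\det\Delta_u=P_u\!\left(\frac{t+t^{-1}}{2}\right).$$ Let $n$ be the degree of $P$ in $x$ and let $(-1)^n\alpha(u)$ be its coefficient of $x^n$. There is $R>0$ such that for all $u\in\mathbb{C}$ with $0<|u|<R$: the product defining $Z_Y^{(2)}(u)^{-1}$ converges (unconditionally), $\alpha(u)\neq 0$, $P_u$ can be written as $P_u(x)=\alpha(u)\prod_{i=1}^n(r_i(u)-x)$ with $r_1(u),\dots,r_n(u)\in\mathbb{C}$ the roots of $P_u$, and $$Z_Y^{(2)}(u)^{-1}=(1-u^2)^{-\chi(X)}\,\frac{\alpha(u)}{2^n}\prod_{i=1}^n\Bigl(r_i(u)+\sqrt{r_i(u)+1}\,\sqrt{r_i(u)-1}\Bigr),$$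 where the square roots are principal, $\sqrt z=\exp(\tfrac12\log z)$ with the principal logarithm. -/

import Mathlib

open scoped LaurentPolynomial Polynomial

set_option linter.checkUnivs false

/-- A graph in the sense of Serre: every geometric edge is a pair of oppositely oriented
darts `e`, `inv e`.  Loops and multiple edges are allowed. -/
structure SerreGraph.{v, w} where
  /-- vertices -/
  V : Type v
  /-- oriented edges -/
  Dart : Type w
  /-- initial vertex -/
  src : Dart → V
  /-- orientation reversal -/
  inv : Dart → Dart
  inv_inv : ∀ e, inv (inv e) = e
  inv_ne : ∀ e, inv e ≠ e

namespace SerreGraph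

/-- The terminal vertex of a dart. -/
def tgt (Y : SerreGraph) (e : Y.Dart) : Y.V := Y.src (Y.inv e)

/-- The degree of a vertex (a loop contributes two). -/
noncomputable def degree (Y : SerreGraph) (v : Y.V) : ℕ := Nat.card {e : Y.Dart // Y.src e = v}

/-- The set of geometric (unoriented) edges. -/
def edges (X : SerreGraph) : Set (Sym2 X.Dart) := Set.range fun e => s(e, X.inv e)

/-- The Euler characteristic (number of vertices minus number of geometric edges) of a
finite graph. -/
noncomputable def eulerChar (X : SerreGraph) : ℤ := (Nat.card X.V : ℤ) - (X.edges.ncard : ℤ)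

/-- `Y.IsWalk v l w`: the list of darts `l` is an edge path from `v` to `w`. -/
def IsWalk (Y : SerreGraph) : Y.V → List Y.Dart → Y.V → Prop
  | v, [], w => v = w
  | v, e :: l, w => Y.src e = v ∧ Y.IsWalk (Y.tgt e) l w

/-- A closed (edge) path, with its base point. -/
structure ClosedPath (Y : SerreGraph) where
  base : Y.V
  darts : List Y.Dart
  isWalk : Y.IsWalk base darts base

/-- Elementary free homotopies between closed paths: removing a backtracking `e, inv e`, and
moving the base point along the first dart. -/
inductive HomotopyStep (Y : SerreGraph) : Y.ClosedPath → Y.ClosedPath → Prop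
  | backtrack (p q : Y.ClosedPath) (l₁ l₂ : List Y.Dart) (e : Y.Dart) (hb : p.base = q.base)
      (hp : p.darts = l₁ ++ e :: Y.inv e :: l₂) (hq : q.darts = l₁ ++ l₂) : HomotopyStep Y p q
  | rotate (p q : Y.ClosedPath) (l : List Y.Dart) (e : Y.Dart) (hb : q.base = Y.tgt e)
      (hp : p.darts = e :: l) (hq : q.darts = l ++ [e]) : HomotopyStep Y p q

/-- Free homotopy of closed paths: the equivalence relation generated by the elementary
free homotopies. -/
def freeHomotopy (Y : SerreGraph) : Setoid Y.ClosedPath := Relation.EqvGen.setoid Y.HomotopyStep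

/-- Free homotopy classes of closed paths. -/
def HomotopyClass (Y : SerreGraph) : Type _ := Quotient Y.freeHomotopy

/-- The free homotopy class of a closed path. -/
def ClosedPath.toClass {Y : SerreGraph} (p : Y.ClosedPath) : Y.HomotopyClass :=
  Quotient.mk Y.freeHomotopy p

/-- The length of the shortest representative of a free homotopy class. -/
noncomputable def HomotopyClass.len {Y : SerreGraph} (γ : Y.HomotopyClass) : ℕ :=
  sInf {m | ∃ p : Y.ClosedPath, p.toClass = γ ∧ p.darts.length = m}

/-- A free homotopy class is primitive if it is not the class of a proper power
`p ^ k` (`p` run through `k` times, `k ≥ 2`) of a closed path.  In particular the class of a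
constant path is not primitive. -/
def HomotopyClass.IsPrimitive {Y : SerreGraph} (γ : Y.HomotopyClass) : Prop :=
  ¬ ∃ (p q : Y.ClosedPath) (k : ℕ), 2 ≤ k ∧ q.base = p.base ∧
      q.darts = (List.replicate k p.darts).flatten ∧ q.toClass = γ

/-- The set `P` of primitive free homotopy classes of closed paths. -/
def PrimitiveClass (Y : SerreGraph) : Type _ := {γ : Y.HomotopyClass // γ.IsPrimitive}

section Action

variable (G : Type*) [Group G]

/-- The actions of `G` on vertices and darts form an action by graph automorphisms. -/
class IsGraphAction (Y : SerreGraph) [MulAction G Y.V] [MulAction G Y.Dart] : Prop where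
  src_smul : ∀ (g : G) (e : Y.Dart), Y.src (g • e) = g • Y.src e
  inv_smul : ∀ (g : G) (e : Y.Dart), Y.inv (g • e) = g • Y.inv e

variable {G} {Y : SerreGraph} [MulAction G Y.V] [MulAction G Y.Dart] [IsGraphAction G Y]

theorem tgt_smul (g : G) (e : Y.Dart) : Y.tgt (g • e) = g • Y.tgt e := by
  simp [tgt, IsGraphAction.src_smul, IsGraphAction.inv_smul]

theorem IsWalk.smul (g : G) {v w : Y.V} {l : List Y.Dart} (h : Y.IsWalk v l w) :
    Y.IsWalk (g • v) (l.map (g • ·)) (g • w) := by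
  induction l generalizing v with
  | nil => simpa [IsWalk] using congrArg (g • ·) h
  | cons e l ih =>
    obtain ⟨h1, h2⟩ := h
    refine ⟨by rw [IsGraphAction.src_smul, h1], ?_⟩
    have := ih h2
    rwa [← tgt_smul] at this

/-- Translation of closed paths. -/
instance : SMul G Y.ClosedPath where
  smul g p := ⟨g • p.base, p.darts.map (g • ·), p.isWalk.smul g⟩

theorem ClosedPath.smul_base (g : G) (p : Y.ClosedPath) : (g • p).base = g • p.base := rfl

theorem ClosedPath.smul_darts (g : G) (p : Y.ClosedPath) :
    (g • p).darts = p.darts.map (g • ·) := rfl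

theorem ClosedPath.eq_iff {p q : Y.ClosedPath} :
    p = q ↔ p.base = q.base ∧ p.darts = q.darts := by
  cases p
  cases q
  simp

instance : MulAction G Y.ClosedPath where
  one_smul p := by simp [ClosedPath.eq_iff, ClosedPath.smul_base, ClosedPath.smul_darts]
  mul_smul g h p := by
    simp [ClosedPath.eq_iff, ClosedPath.smul_base, ClosedPath.smul_darts, mul_smul]

theorem HomotopyStep.smul (g : G) {p q : Y.ClosedPath} (h : Y.HomotopyStep p q) :
    Y.HomotopyStep (g • p) (g • q) := by
  cases h with
  | backtrack l₁ l₂ e hb hp hq =>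
    refine .backtrack _ _ (l₁.map (g • ·)) (l₂.map (g • ·)) (g • e) ?_ ?_ ?_
    · simp [ClosedPath.smul_base, hb]
    · simp [ClosedPath.smul_darts, hp, IsGraphAction.inv_smul]
    · simp [ClosedPath.smul_darts, hq]
  | rotate l e hb hp hq =>
    refine .rotate _ _ (l.map (g • ·)) (g • e) ?_ ?_ ?_
    · simp [ClosedPath.smul_base, hb, tgt_smul]
    · simp [ClosedPath.smul_darts, hp]
    · simp [ClosedPath.smul_darts, hq]

theorem freeHomotopy_smul (g : G) {p q : Y.ClosedPath} (h : Y.freeHomotopy p q) :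
    Y.freeHomotopy (g • p) (g • q) := by
  change Relation.EqvGen _ _ _ at h
  change Relation.EqvGen _ _ _
  induction h with
  | rel _ _ h => exact .rel _ _ (h.smul g)
  | refl _ => exact .refl _
  | symm _ _ _ ih => exact .symm _ _ ih
  | trans _ _ _ _ _ ih1 ih2 => exact .trans _ _ _ ih1 ih2

/-- Translation of free homotopy classes. -/
instance : MulAction G Y.HomotopyClass where
  smul g := Quotient.map (g • ·) fun _ _ h => freeHomotopy_smul g h
  one_smul γ := by
    induction γ using Quotient.inductionOn with
    | h p => exact congrArg ClosedPath.toClass (one_smul G p)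
  mul_smul g h γ := by
    induction γ using Quotient.inductionOn with
    | h p => exact congrArg ClosedPath.toClass (mul_smul g h p)

theorem ClosedPath.smul_toClass (g : G) (p : Y.ClosedPath) :
    g • p.toClass = (g • p).toClass := rfl

theorem HomotopyClass.IsPrimitive.smul (g : G) {γ : Y.HomotopyClass} (h : γ.IsPrimitive) :
    (g • γ).IsPrimitive := by
  rintro ⟨p, q, k, hk, hb, hd, hq⟩
  refine h ⟨g⁻¹ • p, g⁻¹ • q, k, hk, ?_, ?_, ?_⟩
  · simp [ClosedPath.smul_base, hb]
  · simp [ClosedPath.smul_darts, hd, List.map_flatten]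
  · rw [← ClosedPath.smul_toClass, hq, inv_smul_smul]

/-- Translation of primitive free homotopy classes. -/
instance : MulAction G Y.PrimitiveClass where
  smul g γ := ⟨g • γ.1, γ.2.smul g⟩
  one_smul γ := Subtype.ext (one_smul G γ.1)
  mul_smul g h γ := Subtype.ext (mul_smul g h γ.1)

variable (G Y)

/-- The factor `(1 - u ^ len γ) ^ (1 / |G_γ|)` of the Euler product that belongs to an orbit
in `G \ P`; it does not depend on the representative `γ` of the orbit. -/
noncomputable def eulerFactor (u : ℂ)
    (c : MulAction.orbitRel.Quotient G Y.PrimitiveClass) : ℂ :=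
  (1 - u ^ (Quotient.out c).1.len) ^
    (1 / (Nat.card (MulAction.stabilizer G (Quotient.out c)) : ℂ))

/-- The `L²` zeta function of `Y` with respect to `G`, the reciprocal of its Euler product. -/
noncomputable def l2Zeta (u : ℂ) : ℂ := (∏' c, eulerFactor G Y u c)⁻¹

/-- `X` is the quotient of `Y` by a free action of `G`, with `Y → X` the quotient map:
the fibres of a surjective graph morphism are exactly the `G`-orbits, and no nontrivial element
of `G` fixes a vertex.  (It follows that the morphism is bijective on the darts at each
vertex, and that `G` acts freely on the darts.) -/
structure RegularCovering (X : SerreGraph) where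
  onV : Y.V → X.V
  onDart : Y.Dart → X.Dart
  onV_src : ∀ e, onV (Y.src e) = X.src (onDart e)
  onDart_inv : ∀ e, onDart (Y.inv e) = X.inv (onDart e)
  onV_surjective : Function.Surjective onV
  onDart_surjective : Function.Surjective onDart
  onV_eq_iff : ∀ v w, onV v = onV w ↔ ∃ g : G, g • v = w
  onDart_eq_iff : ∀ e f, onDart e = onDart f ↔ ∃ g : G, g • e = f
  free : ∀ (g : G) (v : Y.V), g • v = v → g = 1

end Action

section Laplacian

variable (Y : SerreGraph) [MulAction (Multiplicative ℤ) Y.V] {ι : Type*} (s : ι → Y.V)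

/-- The adjacency operator `(δ f)(v) = ∑_{src e = v} f (tgt e)` of a graph with `ℤ`-action as a
matrix over the group ring `ℂ[t, t⁻¹]` of `ℤ`, with respect to representatives `s` of the
vertex orbits: the coefficient of `t ^ k` in the entry `(a, b)` is the number of darts from
`s a` to `t ^ k • s b`.  (The sum over `k` is finite if there are finitely many darts at
`s a`.) -/
noncomputable def adjacency : Matrix ι ι ℂ[T;T⁻¹] :=
  Matrix.of fun a b => ∑ᶠ k : ℤ, LaurentPolynomial.C
    (Nat.card {e : Y.Dart // Y.src e = s a ∧ Y.tgt e = Multiplicative.ofAdd k • s b} : ℂ) *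
      LaurentPolynomial.T k

/-- `Δ_u = I - u δ + u² Q` as a matrix over `ℂ[t, t⁻¹]`, where `Q` is multiplication by
`q(v) = deg v - 1`. -/
noncomputable def laplacian [DecidableEq ι] (u : ℂ) : Matrix ι ι ℂ[T;T⁻¹] :=
  1 - LaurentPolynomial.C u • Y.adjacency s
    + LaurentPolynomial.C (u ^ 2) •
      Matrix.diagonal fun a => LaurentPolynomial.C ((Y.degree (s a) : ℂ) - 1)

end Laplacian

end SerreGraph

/-- For `P ∈ ℤ[u][x]` and a complex number `u`, the polynomial `P_u ∈ ℂ[x]`. -/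
noncomputable def specialize (P : ℤ[X][X]) (u : ℂ) : ℂ[X] :=
  P.map (Polynomial.eval₂RingHom (Int.castRingHom ℂ) u)

/-- `P ∈ ℤ[u][x]` satisfies `det Δ_u = P_u ((t + t⁻¹) / 2)` for all complex `u`. -/
def SerreGraph.IsDetPolynomial (Y : SerreGraph) [MulAction (Multiplicative ℤ) Y.V]
    {ι : Type*} [Fintype ι] [DecidableEq ι] (s : ι → Y.V) (P : ℤ[X][X]) : Prop :=
  ∀ u : ℂ, (Y.laplacian s u).det =
    Polynomial.aeval (LaurentPolynomial.C (1 / 2 : ℂ) *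
      (LaurentPolynomial.T 1 + LaurentPolynomial.T (-1))) (specialize P u)

/-- The polynomial `α ∈ ℤ[u]` for which `(-1) ^ n α` is the coefficient of the top degree term
`x ^ n` of `P`. -/
noncomputable def signedLeadingCoeff (P : ℤ[X][X]) : ℤ[X] :=
  (-1) ^ P.natDegree * P.leadingCoeff

/-- The principal square root `exp (log z / 2)` (and `0` at `0`). -/
noncomputable def principalSqrt (z : ℂ) : ℂ := z ^ (1 / 2 : ℂ)

/-! Every free homotopy class contains a cyclically reduced closed path, unique up to rotation:
reading geometric edges as free generators, this says that conjugate cyclically reduced words are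
rotations of each other (`FreeGroup.isRotated_of_isConj_mk`). As ℤ is torsion-free and acts freely,
primitive classes have trivial stabilizers, so all exponents in the product are 1, and orbits of
primitive classes correspond to rotation classes of primitive cyclically reduced words of X with
trivial monodromy (`wordOrbit_eq_iff`, `card_fiber`). Expanding logarithms, the Euler product is
exp(-∑ u^|l| / |l|) over all closed reduced words l of X with trivial monodromy
(`hasProd_eulerFactor`).

To isolate trivial monodromy, weight each dart by z^shift with |z| = 1. Over all closed reduced
words, the exponential of minus the weighted sum is det(1 - u W_z) for the weighted edge matrix W_z
(`exp_neg_tsum_closedWords`), and the Ihara–Bass formula (`det_one_sub_edgeMatrix`) turns it into (1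
- u²)^(-χ) P_u((z + z⁻¹)/2). The zeta function asks for the constant Fourier coefficient in z of the
exponent.

With w = r + √(r+1) √(r-1) one has r - (z + z⁻¹)/2 = (w/2)(1 - z/w)(1 - z⁻¹/w), and |w| > 1 because
an exponential never vanishes on the circle. The logarithms of the last two factors have no constant
term, so only (1 - u²)^(-χ) α ∏ w_i/2 survives; `eq_exp_of_factorization` proves this by the mean
value property, without choosing logarithms.

P exists because transposing Δ_u exchanges t and t⁻¹: the determinant over ℤ[u] is a symmetric
Laurent polynomial, hence a polynomial in t + t⁻¹. -/

set_option linter.unusedSectionVars false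

/-! ### Combinatorics of words: rotations, powers, primitive roots. -/

namespace List

variable {α β : Type*}

/-- A list is primitive if it is not a proper power of another list. -/
def IsPrimitive (l : List α) : Prop :=
  ∀ (r : List α) (k : ℕ), 2 ≤ k → l ≠ (replicate k r).flatten

theorem IsPrimitive.ne_nil {l : List α} (h : l.IsPrimitive) : l ≠ [] := by
  rintro rfl
  exact h [] 2 le_rfl (by simp)

theorem length_flatten_replicate (k : ℕ) (r : List α) :
    (replicate k r).flatten.length = k * r.length := by simp

/-- A word commuting with `t` and at least as long has `t` as a prefix; strip it and repeat. -/
theorem eq_flatten_replicate_of_append_comm {t : List α} (k : ℕ) {m : List α}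
    (h : t ++ m = m ++ t) (hm : m.length = k * t.length) : m = (replicate k t).flatten := by
  induction k generalizing m with
  | zero => simpa using hm
  | succ k ih =>
    obtain ⟨m', rfl⟩ : t <+: m := by
      have h1 : t <+: m ++ t := h ▸ prefix_append t m
      exact prefix_of_prefix_length_le h1 (prefix_append m t) (by rw [hm]; nlinarith)
    rw [replicate_succ, flatten_cons, ← ih (by simpa [append_assoc] using h)
      (by simp only [length_append] at hm; linarith)]

theorem eq_flatten_replicate_of_rotate_eq {l : List α} {d k : ℕ} (h : l.rotate d = l)
    (hl : l.length = k * d) (hk : k ≠ 0) : l = (replicate k (l.take d)).flatten := by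
  obtain ⟨k, rfl⟩ := Nat.exists_eq_succ_of_ne_zero hk
  have hd : d ≤ l.length := by rw [hl]; nlinarith
  rw [rotate_eq_drop_append_take hd] at h
  have h2 := eq_flatten_replicate_of_append_comm (t := l.take d) (m := l.drop d) k
    (by rw [take_append_drop, h]) (by simp [hl, Nat.succ_mul])
  rw [replicate_succ, flatten_cons, ← h2, take_append_drop]

theorem rotate_flatten_replicate (k : ℕ) (r : List α) :
    (replicate k r).flatten.rotate r.length = (replicate k r).flatten := by
  cases k with
  | zero => simp
  | succ k =>
    rw [replicate_succ, flatten_cons, rotate_append_length_eq]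
    rw [← flatten_cons, ← replicate_succ, replicate_succ', flatten_concat]

theorem rotate_iterate (l : List α) (n : ℕ) :
    (fun l : List α => l.rotate 1)^[n] l = l.rotate n := by
  induction n with
  | zero => simp
  | succ n ih => rw [Function.iterate_succ_apply', ih, rotate_rotate]

/-- Viewing rotations as iterates of `rotate 1` makes the rotations fixing `l` the multiples of one
number, which replaces gcd arguments below. -/
theorem minimalPeriod_rotate_dvd_iff (l : List α) (n : ℕ) :
    Function.minimalPeriod (fun l : List α => l.rotate 1) l ∣ n ↔ l.rotate n = l := by
  rw [← Function.isPeriodicPt_iff_minimalPeriod_dvd, Function.IsPeriodicPt, Function.IsFixedPt,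
    rotate_iterate]

/-- The minimal rotation period divides the length, so `l` is a power of its prefix of that length;
primitivity makes the exponent 1. -/
theorem IsPrimitive.rotate_eq_self_iff {l : List α} (h : l.IsPrimitive) (n : ℕ) :
    l.rotate n = l ↔ l.length ∣ n := by
  rw [← minimalPeriod_rotate_dvd_iff]
  set d := Function.minimalPeriod (fun l : List α => l.rotate 1) l with hd
  have h1 : d ∣ l.length := (minimalPeriod_rotate_dvd_iff l _).2 (rotate_length l)
  obtain ⟨k, hk⟩ := h1
  have h0 : l.length ≠ 0 := by simpa using h.ne_nil
  have h2 := eq_flatten_replicate_of_rotate_eq (d := d) (k := k)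
    ((minimalPeriod_rotate_dvd_iff l _).1 dvd_rfl) (by rw [hk, mul_comm])
    (by rintro rfl; exact h0 (by rw [hk, mul_zero]))
  have h3 : ¬ 2 ≤ k := fun h4 => h _ _ h4 h2
  have h4 : k = 1 := by
    have : k ≠ 0 := by rintro rfl; exact h0 (by rw [hk, mul_zero])
    omega
  rw [hk, h4, mul_one]

theorem IsPrimitive.rotate_inj {l : List α} (h : l.IsPrimitive) {i j : ℕ} (hi : i < l.length)
    (hj : j < l.length) (hij : l.rotate i = l.rotate j) : i = j := by
  wlog hle : i ≤ j generalizing i j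
  · exact (this hj hi hij.symm (by omega)).symm
  have h1 : (l.rotate (j - i)).rotate i = l.rotate i := by
    rw [rotate_rotate, hij]
    congr 1
    omega
  have h2 := (h.rotate_eq_self_iff _).1 (rotate_injective i h1)
  have := Nat.eq_zero_of_dvd_of_lt h2 (by omega)
  omega

theorem exists_primitive_root (l : List α) (hl : l ≠ []) :
    ∃ (r : List α) (k : ℕ), r.IsPrimitive ∧ l = (replicate (k + 1) r).flatten := by
  induction hn : l.length using Nat.strong_induction_on generalizing l with
  | _ n ih =>
  by_cases h : l.IsPrimitive
  · exact ⟨l, 0, h, by simp⟩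
  · simp only [IsPrimitive, ne_eq, not_forall, not_not] at h
    obtain ⟨r, k, hk, rfl⟩ := h
    have hr : r ≠ [] := by rintro rfl; simp at hl
    have hr' : 0 < r.length := length_pos_iff.2 hr
    obtain ⟨s, j, hs, hj⟩ := ih r.length (by rw [← hn, length_flatten_replicate]; nlinarith)
      r hr rfl
    refine ⟨s, k * (j + 1) - 1, hs, ?_⟩
    have : k * (j + 1) - 1 + 1 = k * (j + 1) :=
      Nat.succ_pred_eq_of_pos (Nat.mul_pos (by omega) (by omega))
    rw [this, hj]
    clear * -
    induction k with
    | zero => simp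
    | succ k ih =>
      rw [replicate_succ, flatten_cons, ih, ← flatten_append, ← replicate_add]
      congr 2
      ring

theorem primitive_root_unique {r s : List α} {k j : ℕ} (hr : r.IsPrimitive) (hs : s.IsPrimitive)
    (h : (replicate (k + 1) r).flatten = (replicate (j + 1) s).flatten) : r = s ∧ k = j := by
  have hr' : 0 < r.length := length_pos_iff.2 hr.ne_nil
  -- The length of a primitive root equals the minimal rotation period `d` of the common power, and
  -- `d` divides the length of any other root. By symmetry the lengths agree.
  have key : ∀ {r s : List α} {k j : ℕ}, r.IsPrimitive → s.IsPrimitive →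
      (replicate (k + 1) r).flatten = (replicate (j + 1) s).flatten → r.length ∣ s.length := by
    intro r s k j hr hs h
    set l := (replicate (k + 1) r).flatten with hl
    set d := Function.minimalPeriod (fun l : List α => l.rotate 1) l
    have h1 : d ∣ r.length := (minimalPeriod_rotate_dvd_iff _ _).2 (rotate_flatten_replicate _ _)
    have h2 : d ∣ s.length := (minimalPeriod_rotate_dvd_iff _ _).2
      (by rw [h]; exact rotate_flatten_replicate _ _)
    obtain ⟨i, hi⟩ := h1
    have hr' : 0 < r.length := length_pos_iff.2 hr.ne_nil
    have hi0 : i ≠ 0 := by rintro rfl; simp_all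
    have hll : l.length = (k + 1) * r.length := length_flatten_replicate _ _
    have h3 := eq_flatten_replicate_of_rotate_eq (l := l) (d := d) (k := (k + 1) * i)
      ((minimalPeriod_rotate_dvd_iff _ _).1 dvd_rfl) (by rw [hll, hi]; ring)
      (by positivity)
    have h4 : r = (replicate i (l.take d)).flatten := by
      have h5 : l = r ++ (replicate k r).flatten := by rw [hl, replicate_succ, flatten_cons]
      have h6 : l = (replicate i (l.take d)).flatten ++ (replicate (k * i) (l.take d)).flatten := by
        rw [← flatten_append, ← replicate_add]
        convert! h3 using 3
        ring
      refine (append_inj (h5.symm.trans h6) ?_).1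
      rw [length_flatten_replicate, length_take, min_eq_left, hi, mul_comm]
      rw [hll, hi]
      have : 1 ≤ i := Nat.one_le_iff_ne_zero.2 hi0
      nlinarith [Nat.zero_le (k * (d * i)), Nat.zero_le d]
    have h7 : ¬ 2 ≤ i := fun h8 => hr _ _ h8 h4
    have h8 : i = 1 := by omega
    rw [hi, h8, mul_one]
    exact h2
  have hlen : r.length = s.length := Nat.dvd_antisymm (key hr hs h) (key hs hr h.symm)
  have h1 := congrArg length h
  rw [length_flatten_replicate, length_flatten_replicate, ← hlen] at h1
  refine ⟨?_, by have := Nat.eq_of_mul_eq_mul_right hr' h1; omega⟩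
  rw [replicate_succ, replicate_succ, flatten_cons, flatten_cons] at h
  exact (append_inj h hlen).1

theorem IsPrimitive.rotate {l : List α} (h : l.IsPrimitive) (n : ℕ) : (l.rotate n).IsPrimitive := by
  intro r k hk hl
  have h1 : l.rotate r.length = l := by
    apply rotate_injective n
    simp only
    rw [rotate_rotate, add_comm, ← rotate_rotate, hl, rotate_flatten_replicate]
  refine h _ k hk (eq_flatten_replicate_of_rotate_eq h1 ?_ (by omega))
  rw [← length_rotate l n, hl, length_flatten_replicate]

theorem IsPrimitive.of_isRotated {l l' : List α} (h : l.IsPrimitive) (hl : l ~r l') :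
    l'.IsPrimitive := by
  obtain ⟨n, rfl⟩ := hl
  exact h.rotate n

theorem IsPrimitive.of_map {l : List α} (f : α → β) (h : (l.map f).IsPrimitive) :
    l.IsPrimitive := by
  rintro r k hk rfl
  exact h (r.map f) k hk (by simp [map_flatten])

end List

/-! ### Cyclic chains under powers and rotations. -/

/-- A cyclic chain is a linear chain with its first letter repeated at the end; successive copies of
`r` are glued along that letter. -/
theorem Cycle.Chain.flatten_replicate {α : Type*} {R : α → α → Prop} {r : List α}
    (h : Cycle.Chain R (r : Cycle α)) (k : ℕ) :
    Cycle.Chain R ((List.replicate k r).flatten : List α) := by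
  rcases r with _ | ⟨a, m⟩
  · simp
  rcases k with _ | k
  · simp
  have h' : List.IsChain R (a :: (m ++ [a])) := h
  suffices List.IsChain R ((List.replicate (k + 1) (a :: m)).flatten ++ [a]) by
    simpa [List.replicate_succ] using this
  induction k with
  | zero => simpa using h'
  | succ k ih =>
    rw [List.replicate_succ', List.flatten_concat, List.append_assoc]
    rw [List.cons_append, List.isChain_split]
    exact ⟨ih, h'⟩

theorem Cycle.Chain.of_flatten_replicate {α : Type*} {R : α → α → Prop} {r : List α} {k : ℕ}
    (h : Cycle.Chain R ((List.replicate (k + 1) r).flatten : List α)) :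
    Cycle.Chain R (r : Cycle α) := by
  rcases r with _ | ⟨a, m⟩
  · simp
  rw [List.replicate_succ, List.flatten_cons, List.cons_append, Cycle.chain_coe_cons] at h
  rw [Cycle.chain_coe_cons]
  refine h.prefix ?_
  rcases k with _ | k
  · simp
  · exact ⟨m ++ (List.replicate k (a :: m)).flatten ++ [a], by simp [List.replicate_succ]⟩

theorem Cycle.Chain.isChain {α : Type*} {R : α → α → Prop} {l : List α}
    (h : Cycle.Chain R (l : Cycle α)) : List.IsChain R l := by
  rcases l with _ | ⟨a, m⟩
  · exact List.isChain_nil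
  · exact List.IsChain.left_of_append (l₂ := [a]) h

theorem Cycle.Chain.of_isRotated {α : Type*} {R : α → α → Prop} {l l' : List α}
    (h : Cycle.Chain R (l : Cycle α)) (hl : l ~r l') : Cycle.Chain R (l' : Cycle α) := by
  rwa [← Cycle.coe_eq_coe.2 hl]

theorem Cycle.chain_coe_map {α β : Type*} (R : β → β → Prop) (f : α → β) (l : List α) :
    Cycle.Chain R (l.map f : Cycle β) ↔ Cycle.Chain (fun a b => R (f a) (f b)) (l : Cycle α) :=
  Cycle.chain_map (r := R) f (s := (l : Cycle α))

/-! ### Conjugate cyclically reduced words in a free group. -/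

namespace FreeGroup

variable {α : Type*}

/-- Adjacent letters of a word do not cancel. -/
abbrev NoCancel (a b : α × Bool) : Prop := a.1 = b.1 → a.2 = b.2

/-- Induction on the conjugator. If its last letter `x` cancels against the start of `w`, or its
inverse against the end, conjugation by `x` only rotates `w` and the conjugator gets shorter. -/
theorem isRotated_of_conj_mk (h w w' : List (α × Bool)) (hh : IsReduced h)
    (hw : Cycle.Chain NoCancel (w : Cycle (α × Bool))) (hw0 : w ≠ [])
    (hw' : Cycle.Chain NoCancel (w' : Cycle (α × Bool)))
    (hc : mk h * mk w * (mk h)⁻¹ = mk w') : w ~r w' := by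
  classical
  induction h using List.reverseRecOn generalizing w with
  | nil =>
    have h1 : mk w = mk w' := by simpa [← one_eq_mk] using hc
    have h2 := reduce.sound h1
    rw [IsReduced.reduce_eq hw.isChain, IsReduced.reduce_eq hw'.isChain] at h2
    rw [h2]
  | append_singleton h x ih =>
    have hh' : IsReduced h := hh.infix (List.prefix_append h [x]).isInfix
    rw [← mul_mk] at hc
    have hx : (mk [x])⁻¹ = mk [(x.1, !x.2)] := by simp [inv_mk, invRev]
    by_cases h1 : ∃ w1, w = (x.1, !x.2) :: w1
    · obtain ⟨w1, rfl⟩ := h1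
      have hr : ((x.1, !x.2) :: w1) ~r (w1 ++ [(x.1, !x.2)]) := List.IsRotated.cons_append_singleton
      refine hr.trans (ih (w1 ++ [(x.1, !x.2)]) hh' (hw.of_isRotated hr) (by simp) ?_)
      have h3 : mk ((x.1, !x.2) :: w1) = (mk [x])⁻¹ * mk w1 := by
        rw [hx, mul_mk, List.singleton_append]
      rw [← hc, h3, ← mul_mk, ← hx]
      group
    by_cases h2 : ∃ w1, w = w1 ++ [x]
    · obtain ⟨w1, rfl⟩ := h2
      have hr : (w1 ++ [x]) ~r (x :: w1) := List.IsRotated.cons_append_singleton.symm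
      refine hr.trans (ih (x :: w1) hh' (hw.of_isRotated hr) (by simp) ?_)
      have h3 : mk (x :: w1) = mk [x] * mk w1 := by rw [mul_mk, List.singleton_append]
      rw [← hc, h3, ← mul_mk]
      group
    -- Without cancellation at either end the conjugated word `L` is already reduced, hence equal to
    -- `w'`.
    exfalso
    obtain ⟨b, w1, rfl⟩ := List.exists_cons_of_ne_nil hw0
    obtain ⟨w2, c, hcw⟩ : ∃ w2 c, b :: w1 = w2 ++ [c] :=
      ⟨_, _, (List.dropLast_append_getLast (List.cons_ne_nil b w1)).symm⟩
    have hxb : NoCancel x b := by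
      intro h3
      by_contra h4
      refine h1 ⟨w1, ?_⟩
      congr 1
      ext
      · exact h3.symm
      · change b.2 = !x.2
        revert h4; cases x.2 <;> cases b.2 <;> simp
    have hcx : NoCancel c (x.1, !x.2) := by
      intro h3
      by_contra h4
      refine h2 ⟨w2, ?_⟩
      rw [hcw]
      congr 2
      ext
      · exact h3
      · revert h4; change ¬ c.2 = !x.2 → c.2 = x.2
        cases x.2 <;> cases c.2 <;> simp
    have hinv : IsReduced (invRev (h ++ [x])) := by
      rw [isReduced_iff_reduce_eq, reduce_invRev, hh.reduce_eq]
    have hinv' : invRev (h ++ [x]) = (x.1, !x.2) :: invRev h := by simp [invRev]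
    set L := h ++ [x] ++ (b :: w1) ++ invRev (h ++ [x]) with hL
    have hred1 : IsReduced (h ++ [x] ++ b :: w1) := by
      refine List.isChain_append.2 ⟨hh, hw.isChain, ?_⟩
      intro a ha d hd
      simp only [List.getLast?_append, List.getLast?_singleton, List.head?_cons] at ha hd
      simp at ha hd
      subst ha hd
      exact hxb
    have hred : IsReduced L := by
      refine List.isChain_append.2 ⟨hred1, hinv, ?_⟩
      intro a ha d hd
      rw [hcw, ← List.append_assoc, List.getLast?_concat] at ha
      rw [hinv'] at hd
      simp at ha hd
      subst ha hd
      exact hcx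
    have hLw : L = w' := by
      have h3 : mk L = mk w' := by
        rw [← hc, hL, ← mul_mk, ← mul_mk, ← inv_mk, ← mul_mk]
      have h4 := reduce.sound h3
      rwa [hred.reduce_eq, IsReduced.reduce_eq hw'.isChain] at h4
    rw [← hLw] at hw'
    -- Then `w'` starts with the first letter `y` of the conjugator and ends with its inverse, so it
    -- is not cyclically reduced.
    obtain ⟨y, h5, hy⟩ := List.exists_cons_of_ne_nil (l := h ++ [x]) (by simp)
    rw [hL, hy] at hw'
    have h6 : invRev (y :: h5) = invRev h5 ++ [(y.1, !y.2)] := by simp [invRev]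
    rw [h6, List.cons_append, List.cons_append, Cycle.chain_coe_cons] at hw'
    have h7 : List.IsChain NoCancel
        ((y :: (h5 ++ b :: w1 ++ invRev h5)) ++ (y.1, !y.2) :: y :: []) := by
      simpa using hw'
    have := (List.isChain_append_cons_cons.1 h7).2.1
    simp [NoCancel] at this

theorem isRotated_of_isConj_mk {w w' : List (α × Bool)}
    (hw : Cycle.Chain NoCancel (w : Cycle (α × Bool)))
    (hw' : Cycle.Chain NoCancel (w' : Cycle (α × Bool)))
    (hc : IsConj (mk w) (mk w')) : w ~r w' := by
  classical
  by_cases hw0 : w = []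
  · subst hw0
    rw [← one_eq_mk, isConj_one_right, one_eq_mk] at hc
    have h1 := reduce.sound hc
    rw [IsReduced.reduce_eq hw'.isChain] at h1
    simp at h1
    rw [← h1]
  · obtain ⟨g, hg⟩ := isConj_iff.1 hc
    refine isRotated_of_conj_mk g.toWord w w' isReduced_toWord hw hw0 hw' ?_
    rwa [mk_toWord]

end FreeGroup

/-! ### Free homotopy classes and cyclically reduced closed paths. -/

namespace SerreGraph

variable (Y : SerreGraph)

/-- Two consecutive darts of an edge path. -/
def Follows (e f : Y.Dart) : Prop := Y.tgt e = Y.src f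

/-- Two consecutive darts of an edge path without backtracking. -/
def FollowsReduced (e f : Y.Dart) : Prop := Y.tgt e = Y.src f ∧ f ≠ Y.inv e

/-- The geometric edge of a dart, together with one of its two orientations. -/
noncomputable def letter (e : Y.Dart) : Sym2 Y.Dart × Bool :=
  open Classical in (s(e, Y.inv e), decide ((s(e, Y.inv e)).out.1 = e))

theorem sym2_inv (e : Y.Dart) : s(Y.inv e, Y.inv (Y.inv e)) = s(e, Y.inv e) := by
  rw [Y.inv_inv, Sym2.eq_swap]

theorem out_edge (e : Y.Dart) :
    (s(e, Y.inv e)).out.1 = e ∨ (s(e, Y.inv e)).out.1 = Y.inv e := by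
  have h : (s(e, Y.inv e)).out.1 ∈ s(e, Y.inv e) := Sym2.out_fst_mem _
  simpa using h

/-- Exactly one of the two orientations is the representative picked by `out`, so reversal becomes
inversion of the letter. -/
theorem letter_inv (e : Y.Dart) : Y.letter (Y.inv e) = ((Y.letter e).1, !(Y.letter e).2) := by
  unfold letter
  rw [sym2_inv]
  have h := Y.inv_ne e
  rcases Y.out_edge e with h1 | h1 <;> simp [h1, h, h.symm]

theorem letter_injective : Function.Injective Y.letter := by
  intro e f h
  have h1 : s(e, Y.inv e) = s(f, Y.inv f) := congrArg Prod.fst h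
  have h2 := congrArg Prod.snd h
  have hf : e = f ∨ e = Y.inv f := by
    have : e ∈ s(f, Y.inv f) := h1 ▸ Sym2.mem_mk_left _ _
    simpa using this
  rcases hf with rfl | rfl
  · rfl
  · rw [letter_inv] at h2
    simp at h2

theorem chain_letter {l : List Y.Dart} (h : Cycle.Chain Y.FollowsReduced (l : Cycle Y.Dart)) :
    Cycle.Chain FreeGroup.NoCancel (l.map Y.letter : Cycle (Sym2 Y.Dart × Bool)) := by
  rw [Cycle.chain_coe_map]
  refine h.imp fun a b hab h1 => ?_
  by_contra h2
  refine hab.2 (Y.letter_injective ?_)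
  rw [letter_inv]
  ext : 1
  · exact h1.symm
  · revert h2
    change ¬ (Y.letter a).2 = (Y.letter b).2 → (Y.letter b).2 = !(Y.letter a).2
    cases (Y.letter a).2 <;> cases (Y.letter b).2 <;> simp

variable {Y}

/-- Removing a backtracking cancels two inverse letters; moving the base point conjugates by the
first letter. -/
theorem isConj_of_freeHomotopy {p q : Y.ClosedPath} (h : Y.freeHomotopy p q) :
    IsConj (FreeGroup.mk (p.darts.map Y.letter)) (FreeGroup.mk (q.darts.map Y.letter)) := by
  change Relation.EqvGen _ _ _ at h
  induction h with
  | rel p q h =>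
    cases h with
    | backtrack l₁ l₂ e hb hp hq =>
      rw [hp, hq]
      have : FreeGroup.mk ((l₁ ++ e :: Y.inv e :: l₂).map Y.letter) =
          FreeGroup.mk ((l₁ ++ l₂).map Y.letter) := by
        simp only [List.map_append, List.map_cons, letter_inv]
        exact Quot.sound FreeGroup.Red.Step.not
      rw [this]
    | rotate l e hb hp hq =>
      rw [hp, hq, isConj_iff]
      refine ⟨(FreeGroup.mk [Y.letter e])⁻¹, ?_⟩
      have h1 : FreeGroup.mk (Y.letter e :: l.map Y.letter) =
          FreeGroup.mk [Y.letter e] * FreeGroup.mk (l.map Y.letter) := by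
        rw [FreeGroup.mul_mk, List.singleton_append]
      rw [List.map_cons, List.map_append, h1, ← FreeGroup.mul_mk, List.map_singleton]
      group
  | refl _ => exact IsConj.refl _
  | symm _ _ _ ih => exact ih.symm
  | trans _ _ _ _ _ ih1 ih2 => exact ih1.trans ih2

theorem isRotated_of_isRotated_map {α β : Type*} {f : α → β} (hf : Function.Injective f)
    {l l' : List α} (h : l.map f ~r l'.map f) : l ~r l' := by
  obtain ⟨n, hn⟩ := h
  exact ⟨n, List.map_injective_iff.2 hf (by rw [List.map_rotate, hn])⟩

theorem isRotated_of_freeHomotopy {p q : Y.ClosedPath}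
    (hp : Cycle.Chain Y.FollowsReduced (p.darts : Cycle Y.Dart))
    (hq : Cycle.Chain Y.FollowsReduced (q.darts : Cycle Y.Dart)) (h : Y.freeHomotopy p q) :
    p.darts ~r q.darts :=
  isRotated_of_isRotated_map Y.letter_injective
    (FreeGroup.isRotated_of_isConj_mk (Y.chain_letter hp) (Y.chain_letter hq)
      (isConj_of_freeHomotopy h))

theorem IsWalk.isChain_append {l : List Y.Dart} {v w : Y.V} (h : Y.IsWalk v l w) (f : Y.Dart)
    (hf : Y.src f = w) : List.IsChain Y.Follows (l ++ [f]) := by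
  induction l generalizing v with
  | nil => exact List.isChain_singleton _
  | cons e l ih =>
    have := ih h.2
    rcases l with _ | ⟨e', l⟩
    · have h2 : Y.tgt e = w := h.2
      simp [Follows, h2, hf]
    · rw [List.cons_append, List.cons_append, List.isChain_cons_cons]
      exact ⟨h.2.1.symm, this⟩

theorem isWalk_of_isChain {l : List Y.Dart} {e f : Y.Dart}
    (h : List.IsChain Y.Follows (e :: (l ++ [f]))) : Y.IsWalk (Y.src e) (e :: l) (Y.src f) := by
  induction l generalizing e with
  | nil => exact ⟨rfl, by simpa [Follows, IsWalk] using h⟩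
  | cons e' l ih =>
    rw [List.cons_append, List.isChain_cons_cons] at h
    have := ih h.2
    rw [← h.1] at this
    exact ⟨rfl, this⟩

theorem isWalk_append {l₁ l₂ : List Y.Dart} {v w : Y.V} :
    Y.IsWalk v (l₁ ++ l₂) w ↔ ∃ x, Y.IsWalk v l₁ x ∧ Y.IsWalk x l₂ w := by
  induction l₁ generalizing v with
  | nil => simp [IsWalk]
  | cons e l ih => simp [IsWalk, ih, and_assoc]

theorem ClosedPath.chain (p : Y.ClosedPath) : Cycle.Chain Y.Follows (p.darts : Cycle Y.Dart) := by
  obtain ⟨v, l, h⟩ := p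
  rcases l with _ | ⟨e, l⟩
  · simp
  · exact h.isChain_append e h.1

/-- The closed path with a given nonempty cyclic sequence of darts. -/
def ClosedPath.ofChain (l : List Y.Dart) (h0 : l ≠ [])
    (h : Cycle.Chain Y.Follows (l : Cycle Y.Dart)) : Y.ClosedPath where
  base := Y.src (l.head h0)
  darts := l
  isWalk := by
    rcases l with _ | ⟨e, l⟩
    · exact absurd rfl h0
    · exact isWalk_of_isChain h

theorem ClosedPath.base_eq (p : Y.ClosedPath) (h0 : p.darts ≠ []) :
    p.base = Y.src (p.darts.head h0) := by
  obtain ⟨v, l, h⟩ := p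
  rcases l with _ | ⟨e, l⟩
  · exact absurd rfl h0
  · exact h.1.symm

theorem ClosedPath.ext_darts {p q : Y.ClosedPath} (h0 : p.darts ≠ []) (h : p.darts = q.darts) :
    p = q := by
  rw [ClosedPath.eq_iff]
  refine ⟨?_, h⟩
  rw [p.base_eq h0, q.base_eq (h ▸ h0)]
  simp [h]

theorem freeHomotopy_of_rotate_one {p q : Y.ClosedPath} (h : p.darts.rotate 1 = q.darts)
    (h0 : p.darts ≠ []) : Y.freeHomotopy p q := by
  obtain ⟨v, l, hw⟩ := p
  rcases l with _ | ⟨e, l⟩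
  · exact absurd rfl h0
  have hq : q.darts = l ++ [e] := by rw [← h]; simp
  refine Relation.EqvGen.rel _ _ (HomotopyStep.rotate _ _ l e ?_ rfl hq)
  rw [q.base_eq (by simp [hq])]
  have h1 := hw.2
  rcases l with _ | ⟨e', l⟩
  · simp only [hq, List.nil_append, List.head_cons]
    have h2 := hw.1
    have h3 : Y.tgt e = v := hw.2
    rw [h2, h3]
  · simp only [hq, List.cons_append, List.head_cons]
    exact h1.1

theorem freeHomotopy_of_isRotated {p q : Y.ClosedPath} (h : p.darts ~r q.darts)
    (h0 : p.darts ≠ []) : Y.freeHomotopy p q := by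
  obtain ⟨n, hn⟩ := h
  induction n generalizing q with
  | zero =>
    rw [ClosedPath.ext_darts h0 (by simpa using hn)]
  | succ n ih =>
    have h1 : p.darts ~r p.darts.rotate n := ⟨n, rfl⟩
    let q' : Y.ClosedPath := ClosedPath.ofChain (p.darts.rotate n) (by simpa using h0)
      (p.chain.of_isRotated h1)
    refine Y.freeHomotopy.trans' (ih (q := q') rfl)
      (freeHomotopy_of_rotate_one ?_ (by simpa [q', ClosedPath.ofChain] using h0))
    rw [← hn]
    exact List.rotate_rotate _ _ _

theorem toClass_eq_iff {p q : Y.ClosedPath} : p.toClass = q.toClass ↔ Y.freeHomotopy p q :=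
  Quotient.eq

theorem exists_shorter_of_not_chain (p : Y.ClosedPath)
    (h : ¬ Cycle.Chain Y.FollowsReduced (p.darts : Cycle Y.Dart)) :
    ∃ q : Y.ClosedPath, Y.freeHomotopy p q ∧ q.darts.length < p.darts.length := by
  have key : ∀ (p : Y.ClosedPath) (l₁ l₂ : List Y.Dart) (e : Y.Dart),
      p.darts = l₁ ++ e :: Y.inv e :: l₂ →
      ∃ q : Y.ClosedPath, Y.freeHomotopy p q ∧ q.darts.length < p.darts.length := by
    rintro ⟨v, l, hw⟩ l₁ l₂ e (rfl : l = _)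
    have hw' : Y.IsWalk v (l₁ ++ l₂) v := by
      rw [isWalk_append] at hw ⊢
      obtain ⟨x, h1, h2, h3, h4⟩ := hw
      refine ⟨x, h1, ?_⟩
      rwa [tgt, Y.inv_inv, h2] at h4
    exact ⟨⟨v, _, hw'⟩, Relation.EqvGen.rel _ _ (.backtrack _ _ l₁ l₂ e rfl rfl rfl), by simp⟩
  have hch := p.chain
  rcases hl : p.darts with _ | ⟨e, l⟩
  · rw [hl] at h; exact absurd (Cycle.Chain.nil _) h
  rw [hl] at h hch
  rw [← hl]
  rw [Cycle.chain_coe_cons] at h hch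
  rw [List.isChain_iff_forall_rel_of_append_cons_cons] at h
  push Not at h
  obtain ⟨a, b, l₁, l₂, h1, h2⟩ := h
  have hab : Y.Follows a b := by
    rw [List.isChain_iff_forall_rel_of_append_cons_cons] at hch
    exact hch h1
  have hb : b = Y.inv a := by
    by_contra hb
    exact h2 ⟨hab, hb⟩
  subst hb
  rcases List.eq_nil_or_concat l₂ with rfl | ⟨l₃, c, rfl⟩
  -- The backtracking straddles the base point: the last dart is `a` and the first its reverse. One
  -- rotation moves it inside the path. A path of a single dart is excluded, since no dart is its
  -- own reverse.
  · have h3 : e :: l = l₁ ++ [a] ∧ e = Y.inv a := by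
      have : (e :: l) ++ [e] = (l₁ ++ [a]) ++ [Y.inv a] := by simpa using h1
      have := List.append_inj' this rfl
      simpa using this
    have hr : (e :: l) ~r (l ++ [e]) := List.IsRotated.cons_append_singleton
    have h0 : p.darts ≠ [] := by simp [hl]
    let q : Y.ClosedPath := ClosedPath.ofChain (l ++ [e]) (by simp) ((hl ▸ p.chain).of_isRotated hr)
    have hpq : Y.freeHomotopy p q := freeHomotopy_of_isRotated (by rw [hl]; exact hr) h0
    rcases l₁ with _ | ⟨f, l₁⟩
    · simp only [List.nil_append, List.cons.injEq] at h3
      exact absurd (h3.2.symm.trans h3.1.1) (Y.inv_ne a)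
    · have h4 : l = l₁ ++ [a] := by simpa using (List.cons.inj h3.1).2
      obtain ⟨q', h5, h6⟩ := key q l₁ [] a (by
        change l ++ [e] = _
        rw [h4, h3.2]; simp)
      refine ⟨q', Y.freeHomotopy.trans' hpq h5, ?_⟩
      have : q.darts.length = p.darts.length := by
        rw [hl]; exact hr.perm.length_eq.symm
      omega
  · refine key p l₁ l₃ a ?_
    have : (e :: l) ++ [e] = (l₁ ++ a :: Y.inv a :: l₃) ++ [c] := by simpa using h1
    rw [hl, (List.append_inj' this rfl).1]

theorem exists_reduced (p : Y.ClosedPath) :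
    ∃ q : Y.ClosedPath, Y.freeHomotopy p q ∧ q.darts.length ≤ p.darts.length ∧
      Cycle.Chain Y.FollowsReduced (q.darts : Cycle Y.Dart) := by
  induction hn : p.darts.length using Nat.strong_induction_on generalizing p with
  | _ n ih =>
  by_cases h : Cycle.Chain Y.FollowsReduced (p.darts : Cycle Y.Dart)
  · exact ⟨p, Y.freeHomotopy.refl' p, hn.le, h⟩
  · obtain ⟨q, h1, h2⟩ := exists_shorter_of_not_chain p h
    obtain ⟨q', h3, h4, h5⟩ := ih _ (hn ▸ h2) q rfl
    exact ⟨q', Y.freeHomotopy.trans' h1 h3, by omega, h5⟩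

/-- Reducing any other representative never lengthens it and ends at a rotation of `p`. -/
theorem len_toClass {p : Y.ClosedPath}
    (hp : Cycle.Chain Y.FollowsReduced (p.darts : Cycle Y.Dart)) :
    p.toClass.len = p.darts.length := by
  refine le_antisymm (Nat.sInf_le ⟨p, rfl, rfl⟩) (le_csInf ⟨_, p, rfl, rfl⟩ ?_)
  rintro m ⟨q, hq, rfl⟩
  obtain ⟨q', h1, h2, h3⟩ := exists_reduced q
  have h4 := isRotated_of_freeHomotopy hp h3 (Y.freeHomotopy.trans' (toClass_eq_iff.1 hq.symm) h1)
  rw [h4.perm.length_eq]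
  exact h2

/-- If the class is a `k`-th power, reduce the root cyclically: its `k`-th power is still cyclically
reduced, hence a rotation of `p.darts`, and rotations of proper powers are proper powers. -/
theorem isPrimitive_toClass_iff {p : Y.ClosedPath}
    (hp : Cycle.Chain Y.FollowsReduced (p.darts : Cycle Y.Dart)) :
    p.toClass.IsPrimitive ↔ p.darts.IsPrimitive := by
  constructor
  · rintro h r k hk hr
    apply h
    have hwalk := p.isWalk
    -- A constant path is its own `k`-th power.
    by_cases h0 : r = []
    · refine ⟨p, p, k, hk, rfl, ?_, rfl⟩
      have : p.darts = [] := by rw [hr, h0]; simp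
      simp [this]
    obtain ⟨k, rfl⟩ : ∃ j, k = j + 1 := ⟨k - 1, by omega⟩
    have hch : Cycle.Chain Y.Follows (r : Cycle Y.Dart) := by
      have := p.chain
      rw [hr] at this
      exact this.of_flatten_replicate
    refine ⟨ClosedPath.ofChain r h0 hch, p, k + 1, hk, ?_, hr, rfl⟩
    rw [p.base_eq (by rw [hr]; simp [h0])]
    obtain ⟨a, r, rfl⟩ := List.exists_cons_of_ne_nil h0
    simp [ClosedPath.ofChain, hr, List.replicate_succ]
  · rintro h ⟨q, q', k, hk, hb, hd, hc⟩
    obtain ⟨q₁, h1, -, h3⟩ := exists_reduced q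
    have h4 : IsConj (FreeGroup.mk ((List.replicate k q₁.darts).flatten.map Y.letter))
        (FreeGroup.mk (p.darts.map Y.letter)) := by
      refine IsConj.trans ?_ (isConj_of_freeHomotopy (toClass_eq_iff.1 hc))
      have h5 := (isConj_of_freeHomotopy h1).symm
      rw [hd, List.map_flatten, List.map_flatten, List.map_replicate, List.map_replicate]
      rw [← FreeGroup.pow_mk, ← FreeGroup.pow_mk]
      exact h5.pow k
    have h5 := isRotated_of_isRotated_map Y.letter_injective
      (FreeGroup.isRotated_of_isConj_mk (Y.chain_letter (h3.flatten_replicate k))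
        (Y.chain_letter hp) h4)
    exact h.of_isRotated h5.symm _ k hk rfl

theorem exists_reduced_rep (γ : Y.HomotopyClass) :
    ∃ p : Y.ClosedPath, p.toClass = γ ∧
      Cycle.Chain Y.FollowsReduced (p.darts : Cycle Y.Dart) := by
  induction γ using Quotient.inductionOn with
  | h p =>
    obtain ⟨q, h1, -, h3⟩ := exists_reduced p
    exact ⟨q, toClass_eq_iff.2 (Y.freeHomotopy.symm' h1), h3⟩

end SerreGraph

/-! ### Translations, path lifting and trivial stabilizers. -/

namespace SerreGraph

section Translation

variable {G : Type*} [Group G] {Y : SerreGraph} [MulAction G Y.V] [MulAction G Y.Dart]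
  [IsGraphAction G Y]

theorem followsReduced_smul_iff (g : G) (e f : Y.Dart) :
    Y.FollowsReduced (g • e) (g • f) ↔ Y.FollowsReduced e f := by
  simp [FollowsReduced, tgt_smul, IsGraphAction.src_smul, IsGraphAction.inv_smul]

theorem chain_smul_iff (g : G) (l : List Y.Dart) :
    Cycle.Chain Y.FollowsReduced (l.map (g • ·) : Cycle Y.Dart) ↔
      Cycle.Chain Y.FollowsReduced (l : Cycle Y.Dart) := by
  rw [Cycle.chain_coe_map]
  simp only [followsReduced_smul_iff]

theorem map_smul_map_smul (g h : G) (l : List Y.Dart) :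
    (l.map (h • ·)).map (g • ·) = l.map ((g * h) • ·) := by
  simp [mul_smul]

theorem rotate_pow_of_rotate_eq_smul {g : G} {l : List Y.Dart} {i : ℕ}
    (h : l.rotate i = l.map (g • ·)) (n : ℕ) : l.rotate (i * n) = l.map ((g ^ n) • ·) := by
  induction n with
  | zero => simp
  | succ n ih =>
    rw [Nat.mul_succ, ← List.rotate_rotate, ih, ← List.map_rotate, h, map_smul_map_smul, pow_succ]

/-- The length of the primitive classes in an orbit. -/
noncomputable def orbitLen (c : MulAction.orbitRel.Quotient G Y.PrimitiveClass) : ℕ :=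
  (Quotient.out c).1.len

end Translation

namespace RegularCovering

section Lifts

variable {G : Type*} [Group G] {X Y : SerreGraph} [MulAction G Y.V] [MulAction G Y.Dart]
  [IsGraphAction G Y] (p : RegularCovering G Y X)

theorem onV_tgt (e : Y.Dart) : p.onV (Y.tgt e) = X.tgt (p.onDart e) := by
  rw [tgt, tgt, p.onV_src, p.onDart_inv]

theorem onV_smul (g : G) (v : Y.V) : p.onV (g • v) = p.onV v :=
  ((p.onV_eq_iff _ _).2 ⟨g, rfl⟩).symm

theorem onDart_smul (g : G) (e : Y.Dart) : p.onDart (g • e) = p.onDart e :=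
  ((p.onDart_eq_iff _ _).2 ⟨g, rfl⟩).symm

include p in
theorem smul_vertex_injective {g h : G} {v : Y.V} (hg : g • v = h • v) : g = h := by
  have : (h⁻¹ * g) • v = v := by rw [mul_smul, hg, inv_smul_smul]
  have := p.free _ _ this
  rwa [inv_mul_eq_one, eq_comm] at this

include p in
theorem eq_one_of_smul_dart {g : G} {e : Y.Dart} (hg : g • e = e) : g = 1 :=
  p.free g (Y.src e) (by rw [← IsGraphAction.src_smul, hg])

/-- Darts over the same dart are translates, and by freeness a translation fixing the source is
trivial. Unique path lifting rests on this. -/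
theorem dart_ext {e f : Y.Dart} (h : p.onDart e = p.onDart f) (hs : Y.src e = Y.src f) :
    e = f := by
  obtain ⟨g, rfl⟩ := (p.onDart_eq_iff e f).1 h
  rw [IsGraphAction.src_smul] at hs
  rw [p.free g _ hs.symm, one_smul]

theorem exists_lift_dart (x : X.Dart) (v : Y.V) (hv : p.onV v = X.src x) :
    ∃ e, p.onDart e = x ∧ Y.src e = v := by
  obtain ⟨e, rfl⟩ := p.onDart_surjective x
  rw [← p.onV_src, eq_comm, p.onV_eq_iff] at hv
  obtain ⟨g, hg⟩ := hv
  exact ⟨g • e, p.onDart_smul g e, by rw [IsGraphAction.src_smul, hg]⟩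

theorem exists_lift_walk {l : List X.Dart} {a b : X.V} (h : X.IsWalk a l b) (v : Y.V)
    (hv : p.onV v = a) : ∃ l' w, Y.IsWalk v l' w ∧ l'.map p.onDart = l ∧ p.onV w = b := by
  induction l generalizing a v with
  | nil => exact ⟨[], v, rfl, rfl, hv.trans h⟩
  | cons x l ih =>
    obtain ⟨e, he, hev⟩ := p.exists_lift_dart x v (hv.trans h.1.symm)
    obtain ⟨l', w, h1, h2, h3⟩ := ih h.2 (Y.tgt e) (by rw [p.onV_tgt, he])
    exact ⟨e :: l', w, ⟨hev, h1⟩, by simp [he, h2], h3⟩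

theorem walk_unique {l l' : List Y.Dart} {v w w' : Y.V} (h : Y.IsWalk v l w)
    (h' : Y.IsWalk v l' w') (hl : l.map p.onDart = l'.map p.onDart) : l = l' := by
  induction l generalizing v l' with
  | nil => simpa [eq_comm] using hl
  | cons e l ih =>
    rcases l' with _ | ⟨e', l'⟩
    · simp at hl
    · simp only [List.map_cons, List.cons.injEq] at hl
      obtain rfl := p.dart_ext hl.1 (h.1.trans h'.1.symm)
      rw [ih h.2 h'.2 hl.2]

/-- Translate the base points onto each other and lift uniquely. Constant paths must be excluded:
their empty dart lists do not record the vertex. -/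
theorem exists_smul_eq_of_map_eq (q q' : Y.ClosedPath) (h0 : q.darts ≠ [])
    (h : q.darts.map p.onDart = q'.darts.map p.onDart) : ∃ g : G, g • q = q' := by
  have h0' : q'.darts ≠ [] := by
    intro h1
    simp [h1] at h
    exact h0 h
  have hb : p.onV q.base = p.onV q'.base := by
    rw [q.base_eq h0, q'.base_eq h0', p.onV_src, p.onV_src]
    obtain ⟨e, l, hl⟩ := List.exists_cons_of_ne_nil h0
    obtain ⟨e', l', hl'⟩ := List.exists_cons_of_ne_nil h0'
    rw [hl, hl', List.map_cons, List.map_cons, List.cons.injEq] at h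
    simp only [hl, hl', List.head_cons, h.1]
  obtain ⟨g, hg⟩ := (p.onV_eq_iff _ _).1 hb
  refine ⟨g, ?_⟩
  have h1 : (g • q).darts = q'.darts := by
    refine p.walk_unique (g • q).isWalk (v := g • q.base) (w := (g • q).base) (w' := q'.base) ?_ ?_
    · rw [hg]; exact q'.isWalk
    · rw [ClosedPath.smul_darts, List.map_map, ← h]
      congr 1
      ext e
      exact p.onDart_smul g e
  exact ClosedPath.ext_darts (by simpa [ClosedPath.smul_darts] using h0) h1

theorem followsReduced_onDart_iff {e f : Y.Dart} (h : Y.Follows e f) :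
    X.FollowsReduced (p.onDart e) (p.onDart f) ↔ Y.FollowsReduced e f := by
  have h1 : X.tgt (p.onDart e) = X.src (p.onDart f) := by
    rw [← p.onV_tgt, ← p.onV_src, h]
  have h' : Y.tgt e = Y.src f := h
  simp only [FollowsReduced, h1, h', true_and, ← p.onDart_inv, ne_eq]
  rw [not_iff_not]
  refine ⟨fun h2 => p.dart_ext h2 ?_, fun h2 => by rw [h2]⟩
  rw [← h', tgt]

theorem chain_map_onDart_iff (q : Y.ClosedPath) :
    Cycle.Chain X.FollowsReduced (q.darts.map p.onDart : Cycle X.Dart) ↔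
      Cycle.Chain Y.FollowsReduced (q.darts : Cycle Y.Dart) := by
  rw [Cycle.chain_coe_map]
  have h := q.chain
  revert h
  rcases q.darts with _ | ⟨e, l⟩ <;> intro h
  · simp
  · rw [Cycle.chain_coe_cons] at h ⊢
    rw [Cycle.chain_coe_cons]
    simp only [List.isChain_iff_forall_rel_of_append_cons_cons] at h ⊢
    constructor
    · intro h1 a b l₁ l₂ h2
      exact (p.followsReduced_onDart_iff (h h2)).1 (h1 h2)
    · intro h1 a b l₁ l₂ h2
      exact (p.followsReduced_onDart_iff (h h2)).2 (h1 h2)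

variable [IsMulTorsionFree G]

include p in
-- Repeating the rotation `l.length` times gives the identity, so `g ^ l.length` fixes a dart;
-- freeness and torsion-freeness then kill `g`.
theorem eq_one_of_rotate_eq_smul {g : G} {l : List Y.Dart} {i : ℕ} (h0 : l ≠ [])
    (h : l.rotate i = l.map (g • ·)) : g = 1 := by
  have h1 := rotate_pow_of_rotate_eq_smul h l.length
  rw [mul_comm, List.rotate_length_mul] at h1
  obtain ⟨e, l', hl⟩ := List.exists_cons_of_ne_nil h0
  have h2 : g ^ l.length • e = e := by
    conv at h1 => rw [hl]
    simp only [List.map_cons, List.cons.injEq] at h1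
    simpa [hl] using h1.1.symm
  exact (pow_eq_one_iff_left (by simp [hl])).1 (p.eq_one_of_smul_dart h2)

/-- If the image is a power of `r`, the rotation of `q` by `r.length` has the same image, so it is a
translate of `q`. That translation is trivial, so `q` has the same rotation period. -/
theorem isPrimitive_map_iff (q : Y.ClosedPath) :
    (q.darts.map p.onDart).IsPrimitive ↔ q.darts.IsPrimitive := by
  refine ⟨fun h => h.of_map, fun h => ?_⟩
  intro r k hk hr
  have h0 : q.darts ≠ [] := h.ne_nil
  let q' : Y.ClosedPath := ClosedPath.ofChain (q.darts.rotate r.length) (by simpa using h0)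
    (q.chain.of_isRotated ⟨_, rfl⟩)
  have hq' : q.darts.map p.onDart = q'.darts.map p.onDart := by
    change _ = (q.darts.rotate r.length).map p.onDart
    rw [List.map_rotate, hr, List.rotate_flatten_replicate]
  obtain ⟨g, hg⟩ := p.exists_smul_eq_of_map_eq q q' h0 hq'
  have h1 : q.darts.rotate r.length = q.darts.map (g • ·) := by
    have : q'.darts = (g • q).darts := by rw [hg]
    exact this
  have h2 := p.eq_one_of_rotate_eq_smul h0 h1
  subst h2
  simp only [one_smul, List.map_id'] at h1
  refine h _ k hk (List.eq_flatten_replicate_of_rotate_eq h1 ?_ (by omega))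
  rw [← List.length_map (f := p.onDart), hr, List.length_flatten_replicate]

include p in
theorem stabilizer_eq_bot (γ : Y.PrimitiveClass) : MulAction.stabilizer G γ = ⊥ := by
  rw [eq_bot_iff]
  intro g hg
  obtain ⟨q, hq, hch⟩ := exists_reduced_rep γ.1
  have hprim : q.darts.IsPrimitive := (isPrimitive_toClass_iff hch).1 (hq ▸ γ.2)
  have h1 : (g • q).toClass = q.toClass := by
    rw [← ClosedPath.smul_toClass, hq]
    exact congrArg Subtype.val hg
  have h2 := isRotated_of_freeHomotopy hch ((chain_smul_iff g q.darts).2 hch)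
    (toClass_eq_iff.1 h1.symm)
  obtain ⟨i, hi⟩ := h2
  exact p.eq_one_of_rotate_eq_smul hprim.ne_nil hi

include p in
theorem eulerFactor_eq (u : ℂ) (c : MulAction.orbitRel.Quotient G Y.PrimitiveClass) :
    eulerFactor G Y u c = 1 - u ^ orbitLen c := by
  rw [eulerFactor, p.stabilizer_eq_bot]
  simp [orbitLen]

end Lifts

/-! ### Monodromy, and orbits of primitive classes as cyclic words of the base. -/

section Monodromy

variable {G : Type*} [CommGroup G] {X Y : SerreGraph} [MulAction G Y.V] [MulAction G Y.Dart]
  [IsGraphAction G Y] (p : RegularCovering G Y X) (s : X.V → Y.V) (hs : ∀ a, p.onV (s a) = a)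

include hs in
theorem exists_pos (v : Y.V) : ∃ g : G, g • s (p.onV v) = v :=
  (p.onV_eq_iff _ _).1 (hs _)

/-- The group element that translates the chosen vertex of the fibre of `v` to `v`. -/
noncomputable def pos (v : Y.V) : G := (p.exists_pos s hs v).choose

theorem pos_smul (v : Y.V) : p.pos s hs v • s (p.onV v) = v := (p.exists_pos s hs v).choose_spec

theorem pos_eq_iff (v : Y.V) (g : G) : p.pos s hs v = g ↔ v = g • s (p.onV v) := by
  refine ⟨fun h => by rw [← h, p.pos_smul], fun h => ?_⟩
  refine p.smul_vertex_injective (v := s (p.onV v)) ?_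
  rw [p.pos_smul, ← h]

theorem pos_section (a : X.V) : p.pos s hs (s a) = 1 := by
  rw [pos_eq_iff, hs, one_smul]

theorem pos_translate (g : G) (v : Y.V) : p.pos s hs (g • v) = g * p.pos s hs v := by
  rw [pos_eq_iff, p.onV_smul, mul_smul, p.pos_smul]

include hs in
theorem exists_monodromy (x : X.Dart) : ∃ e, p.onDart e = x ∧ Y.src e = s (X.src x) :=
  p.exists_lift_dart x _ (hs _)

/-- The dart over `x` that starts at the chosen vertex. -/
noncomputable def lift (x : X.Dart) : Y.Dart := (p.exists_monodromy s hs x).choose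

theorem onDart_lift (x : X.Dart) : p.onDart (p.lift s hs x) = x :=
  (p.exists_monodromy s hs x).choose_spec.1

theorem src_lift (x : X.Dart) : Y.src (p.lift s hs x) = s (X.src x) :=
  (p.exists_monodromy s hs x).choose_spec.2

/-- The monodromy of a dart of the base with respect to the chosen vertices. -/
noncomputable def monodromy (x : X.Dart) : G := p.pos s hs (Y.tgt (p.lift s hs x))

theorem tgt_lift (x : X.Dart) : Y.tgt (p.lift s hs x) = p.monodromy s hs x • s (X.tgt x) := by
  have h := p.pos_smul s hs (Y.tgt (p.lift s hs x))
  rw [p.onV_tgt, p.onDart_lift] at h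
  exact h.symm

theorem eq_smul_lift (e : Y.Dart) :
    e = p.pos s hs (Y.src e) • p.lift s hs (p.onDart e) := by
  refine p.dart_ext ?_ ?_
  · rw [p.onDart_smul, p.onDart_lift]
  · rw [IsGraphAction.src_smul, p.src_lift, ← p.onV_src, p.pos_smul]

theorem pos_tgt (e : Y.Dart) :
    p.pos s hs (Y.tgt e) = p.pos s hs (Y.src e) * p.monodromy s hs (p.onDart e) := by
  conv_lhs => rw [p.eq_smul_lift s hs e]
  rw [tgt_smul, pos_translate, monodromy]

theorem monodromy_inv (x : X.Dart) : p.monodromy s hs (X.inv x) = (p.monodromy s hs x)⁻¹ := by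
  have h := p.pos_tgt s hs (Y.inv (p.lift s hs x))
  rw [p.onDart_inv, p.onDart_lift, tgt, Y.inv_inv, p.src_lift, pos_section] at h
  change 1 = p.pos s hs (Y.tgt _) * _ at h
  rw [eq_inv_iff_mul_eq_one, mul_comm]
  exact h.symm

/-- `pos_tgt` telescoped: the lift of a closed path closes up exactly when its monodromy is trivial.
-/
theorem pos_end {l : List Y.Dart} {v w : Y.V} (h : Y.IsWalk v l w) :
    p.pos s hs w = p.pos s hs v * ((l.map p.onDart).map (p.monodromy s hs)).prod := by
  induction l generalizing v with
  | nil =>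
    have h1 : v = w := h
    simp [h1]
  | cons e l ih =>
    rw [ih h.2, p.pos_tgt, h.1]
    simp [mul_assoc]

theorem monodromy_closedPath (q : Y.ClosedPath) :
    ((q.darts.map p.onDart).map (p.monodromy s hs)).prod = 1 := by
  have := p.pos_end s hs q.isWalk
  rwa [left_eq_mul] at this

/-- A closed path in the base with trivial monodromy lifts to a closed path. -/
theorem exists_lift_closedPath (q : X.ClosedPath)
    (h : (q.darts.map (p.monodromy s hs)).prod = 1) :
    ∃ q' : Y.ClosedPath, q'.darts.map p.onDart = q.darts := by
  obtain ⟨l', w, h1, h2, h3⟩ := p.exists_lift_walk q.isWalk (s q.base) (hs _)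
  have h4 := p.pos_end s hs h1
  rw [h2, h, mul_one, pos_section, pos_eq_iff, one_smul, h3] at h4
  rw [h4] at h1
  exact ⟨⟨_, l', h1⟩, h2⟩

/-- The closed reduced cyclic words of the base with trivial monodromy. -/
def words : Set (List X.Dart) :=
  {r | r ≠ [] ∧ Cycle.Chain X.FollowsReduced (r : Cycle X.Dart) ∧
    (r.map (p.monodromy s hs)).prod = 1}

/-- The closed reduced cyclic words of the base with trivial monodromy that are not proper
powers. -/
def primitiveWords : Set (List X.Dart) := {r | r ∈ p.words s hs ∧ r.IsPrimitive}

/-- Commutativity of `G` makes the monodromy independent of the starting dart. -/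
theorem words_of_isRotated {r r' : List X.Dart} (h : r ∈ p.words s hs) (hr : r ~r r') :
    r' ∈ p.words s hs := by
  refine ⟨?_, h.2.1.of_isRotated hr, ?_⟩
  · rintro rfl
    exact h.1 (List.isRotated_nil_iff.1 hr)
  · rw [← h.2.2]
    exact ((hr.perm.map _).prod_eq).symm

theorem primitiveWords_of_isRotated {r r' : List X.Dart} (h : r ∈ p.primitiveWords s hs)
    (hr : r ~r r') : r' ∈ p.primitiveWords s hs :=
  ⟨p.words_of_isRotated s hs h.1 hr, h.2.of_isRotated hr⟩

theorem prod_map_flatten_replicate {α : Type*} (f : α → G) (k : ℕ) (r : List α) :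
    ((List.replicate k r).flatten.map f).prod = (r.map f).prod ^ k := by
  simp [List.map_flatten, List.prod_flatten]

variable [IsMulTorsionFree G]

/-- The monodromy of a power is the power of the monodromy, so torsion-freeness passes triviality to
the root. -/
theorem flatten_replicate_mem_words_iff {r : List X.Dart} (k : ℕ) :
    (List.replicate (k + 1) r).flatten ∈ p.words s hs ↔ r ∈ p.words s hs := by
  refine and_congr (by simp [List.replicate_succ]; tauto) (and_congr
    ⟨fun h => h.of_flatten_replicate, fun h => h.flatten_replicate _⟩ ?_)
  rw [prod_map_flatten_replicate, pow_eq_one_iff_left (by omega)]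

/-- Every closed reduced word is a power of a primitive one, in a unique way. -/
noncomputable def wordsEquiv : p.primitiveWords s hs × ℕ ≃ p.words s hs :=
  Equiv.ofBijective
    (fun rk => ⟨(List.replicate (rk.2 + 1) rk.1.1).flatten,
      (p.flatten_replicate_mem_words_iff s hs _).2 rk.1.2.1⟩) <| by
    constructor
    · rintro ⟨⟨r, hr⟩, k⟩ ⟨⟨r', hr'⟩, k'⟩ h
      obtain ⟨rfl, rfl⟩ := List.primitive_root_unique hr.2 hr'.2 (congrArg Subtype.val h)
      rfl
    · rintro ⟨l, hl⟩
      obtain ⟨r, k, hr, rfl⟩ := List.exists_primitive_root l hl.1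
      exact ⟨⟨⟨r, (p.flatten_replicate_mem_words_iff s hs _).1 hl, hr⟩, k⟩, rfl⟩

theorem length_wordsEquiv (r : p.primitiveWords s hs) (k : ℕ) :
    (p.wordsEquiv s hs (r, k)).1.length = (k + 1) * r.1.length :=
  List.length_flatten_replicate _ _

theorem exists_lift_word (r : p.primitiveWords s hs) : ∃ q : Y.ClosedPath,
    q.darts.map p.onDart = r.1 ∧ Cycle.Chain Y.FollowsReduced (q.darts : Cycle Y.Dart) := by
  obtain ⟨q, hq⟩ := p.exists_lift_closedPath s hs
    (ClosedPath.ofChain r.1 r.2.1.1 (r.2.1.2.1.imp fun _ _ h => h.1)) r.2.1.2.2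
  have hq' : q.darts.map p.onDart = r.1 := hq
  exact ⟨q, hq', (p.chain_map_onDart_iff q).1 (by rw [hq']; exact r.2.1.2.1)⟩

/-- A closed path over a closed reduced word with trivial monodromy. -/
noncomputable def liftWord (r : p.primitiveWords s hs) : Y.ClosedPath :=
  (p.exists_lift_word s hs r).choose

theorem map_liftWord (r : p.primitiveWords s hs) :
    (p.liftWord s hs r).darts.map p.onDart = r.1 := (p.exists_lift_word s hs r).choose_spec.1

theorem chain_liftWord (r : p.primitiveWords s hs) :
    Cycle.Chain Y.FollowsReduced ((p.liftWord s hs r).darts : Cycle Y.Dart) :=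
  (p.exists_lift_word s hs r).choose_spec.2

theorem liftWord_ne_nil (r : p.primitiveWords s hs) : (p.liftWord s hs r).darts ≠ [] := by
  intro h
  have := p.map_liftWord s hs r
  rw [h] at this
  exact r.2.1.1 this.symm

/-- The primitive homotopy class of the lift of a primitive word. -/
noncomputable def wordClass (r : p.primitiveWords s hs) : Y.PrimitiveClass :=
  ⟨(p.liftWord s hs r).toClass, (isPrimitive_toClass_iff (p.chain_liftWord s hs r)).2
    ((p.isPrimitive_map_iff _).1 (by rw [map_liftWord]; exact r.2.2))⟩

/-- The orbit of the primitive homotopy class of the lift of a primitive word. -/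
noncomputable def wordOrbit (r : p.primitiveWords s hs) :
    MulAction.orbitRel.Quotient G Y.PrimitiveClass :=
  Quotient.mk _ (p.wordClass s hs r)

theorem wordOrbit_eq_iff_class (r : p.primitiveWords s hs) (γ : Y.PrimitiveClass) :
    p.wordOrbit s hs r = Quotient.mk _ γ ↔ ∃ g : G, (g • (p.liftWord s hs r)).toClass = γ.1 := by
  rw [eq_comm]
  unfold wordOrbit
  rw [Quotient.eq, MulAction.orbitRel_apply, MulAction.mem_orbit_iff]
  exact exists_congr fun g => Subtype.ext_iff

/-- Homotopic reduced paths are rotations, and translations disappear in the base. Conversely, a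
rotation in the base is realized on the lift, and paths with equal nonempty images are translates.
-/
theorem wordOrbit_eq_mk_iff (r : p.primitiveWords s hs) (q : Y.ClosedPath)
    (hq : Cycle.Chain Y.FollowsReduced (q.darts : Cycle Y.Dart))
    (γ : Y.PrimitiveClass) (hq' : γ.1 = q.toClass) :
    p.wordOrbit s hs r = Quotient.mk _ γ ↔ r.1 ~r q.darts.map p.onDart := by
  have hmap : ∀ g : G, ∀ q : Y.ClosedPath,
      (g • q).darts.map p.onDart = q.darts.map p.onDart := fun g q => by
    rw [ClosedPath.smul_darts, List.map_map]
    exact congrArg (List.map · _) (funext fun e => p.onDart_smul g e)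
  rw [wordOrbit_eq_iff_class, hq']
  constructor
  · rintro ⟨g, hg⟩
    have h1 := isRotated_of_freeHomotopy
      ((chain_smul_iff g _).2 (p.chain_liftWord s hs r)) hq (toClass_eq_iff.1 hg)
    have h2 := h1.map p.onDart
    rwa [hmap, map_liftWord] at h2
  · intro h
    have h0 := p.liftWord_ne_nil s hs r
    obtain ⟨i, hi⟩ := h
    let q' : Y.ClosedPath := ClosedPath.ofChain ((p.liftWord s hs r).darts.rotate i)
      (by simpa using h0) ((p.liftWord s hs r).chain.of_isRotated ⟨_, rfl⟩)
    have h1 : q'.darts.map p.onDart = q.darts.map p.onDart := by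
      change ((p.liftWord s hs r).darts.rotate i).map p.onDart = _
      rw [List.map_rotate, map_liftWord, hi]
    obtain ⟨g, hg⟩ := p.exists_smul_eq_of_map_eq q' q
      (by simpa [q', ClosedPath.ofChain] using h0) h1
    refine ⟨g, ?_⟩
    rw [← hg, ← ClosedPath.smul_toClass, ← ClosedPath.smul_toClass]
    congr 1
    exact toClass_eq_iff.2 (freeHomotopy_of_isRotated ⟨i, rfl⟩ h0)

theorem wordOrbit_eq_iff (r r' : p.primitiveWords s hs) :
    p.wordOrbit s hs r = p.wordOrbit s hs r' ↔ r.1 ~r r'.1 := by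
  conv_rhs => rw [← p.map_liftWord s hs r']
  exact p.wordOrbit_eq_mk_iff s hs r _ (p.chain_liftWord s hs r') (p.wordClass s hs r') rfl

theorem wordOrbit_surjective : Function.Surjective (p.wordOrbit s hs) := by
  intro c
  induction c using Quotient.inductionOn with
  | h γ =>
  obtain ⟨γ, hγ⟩ := γ
  obtain ⟨q, rfl, hch⟩ := exists_reduced_rep γ
  have hprim := (isPrimitive_toClass_iff hch).1 hγ
  exact ⟨⟨q.darts.map p.onDart, ⟨by simpa using hprim.ne_nil, (p.chain_map_onDart_iff q).2 hch,
    p.monodromy_closedPath s hs q⟩, (p.isPrimitive_map_iff q).2 hprim⟩,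
    (p.wordOrbit_eq_mk_iff s hs _ q hch _ rfl).2 (List.IsRotated.refl _)⟩

theorem orbitLen_wordOrbit (r : p.primitiveWords s hs) :
    orbitLen (p.wordOrbit s hs r) = r.1.length := by
  obtain ⟨g, hg⟩ := (p.wordOrbit_eq_iff_class s hs r (Quotient.out (p.wordOrbit s hs r))).1
    (Quotient.out_eq _).symm
  rw [orbitLen, ← hg, len_toClass ((chain_smul_iff g _).2 (p.chain_liftWord s hs r)),
    ClosedPath.smul_darts, List.length_map, ← List.length_map (f := p.onDart), map_liftWord]

/-- The fibre consists of the rotations of one word, pairwise distinct by primitivity. This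
multiplicity absorbs the factor 1/length in the logarithmic sum. -/
theorem card_fiber (c : MulAction.orbitRel.Quotient G Y.PrimitiveClass) :
    Nat.card {r : p.primitiveWords s hs // p.wordOrbit s hs r = c} = orbitLen c := by
  obtain ⟨r, rfl⟩ := p.wordOrbit_surjective s hs c
  rw [orbitLen_wordOrbit, ← Nat.card_fin r.1.length]
  symm
  refine Nat.card_congr (Equiv.ofBijective
    (fun i => ⟨⟨r.1.rotate i, p.primitiveWords_of_isRotated s hs r.2 ⟨i, rfl⟩⟩,
      (p.wordOrbit_eq_iff s hs _ _).2 (List.IsRotated.forall r.1 i)⟩) ⟨?_, ?_⟩)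
  · intro i j h
    exact Fin.ext (r.2.2.rotate_inj i.2 j.2 (congrArg (fun x => x.1.1) h))
  · rintro ⟨⟨r', hr'⟩, h⟩
    obtain ⟨n, hn⟩ := ((p.wordOrbit_eq_iff s hs _ _).1 h).symm
    have h0 : 0 < r.1.length := List.length_pos_iff.2 r.2.1.1
    refine ⟨⟨n % r.1.length, Nat.mod_lt _ h0⟩, ?_⟩
    apply Subtype.ext
    apply Subtype.ext
    change r.1.rotate (n % r.1.length) = r'
    rw [List.rotate_mod]
    exact hn

end Monodromy

end RegularCovering

end SerreGraph

/-! ### Convergence, and the Euler product as a sum over words. -/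

/-- There are `card α ^ n` words of length `n`, so grouping by length gives a geometric series. -/
theorem summable_pow_length {α : Type*} [Fintype α] {x : ℝ} (hx : 0 ≤ x)
    (h : Fintype.card α * x < 1) : Summable fun l : List α => x ^ l.length := by
  rw [← (Equiv.sigmaFiberEquiv (List.length (α := α))).summable_iff,
    summable_sigma_of_nonneg (fun _ => by simp only [Function.comp]; positivity)]
  have h1 : ∀ n : ℕ, HasSum (fun l : {l : List α // l.length = n} =>
      ((fun l : List α => x ^ l.length) ∘ Equiv.sigmaFiberEquiv List.length) ⟨n, l⟩)
      ((Fintype.card α * x) ^ n) := by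
    intro n
    let _ : Fintype {l : List α // l.length = n} := inferInstanceAs (Fintype (List.Vector α n))
    have h2 : Fintype.card {l : List α // l.length = n} = Fintype.card α ^ n := card_vector n
    convert! hasSum_fintype _ using 1
    rw [Finset.sum_congr rfl (g := fun _ => x ^ n), Finset.sum_const, Finset.card_univ, h2,
      mul_pow]
    · simp
    · rintro ⟨l, rfl⟩ -
      rfl
  refine ⟨fun n => (h1 n).summable, ?_⟩
  rw [funext fun n => (h1 n).tsum_eq]
  exact summable_geometric_of_lt_one (by positivity) h

theorem summable_pow_length_div {α : Type*} [Fintype α] {u : ℂ}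
    (h : Fintype.card α * ‖u‖ < 1) :
    Summable fun l : List α => ‖u ^ l.length / (l.length : ℂ)‖ := by
  refine Summable.of_nonneg_of_le (fun _ => norm_nonneg _) (fun l => ?_)
    (summable_pow_length (norm_nonneg u) h)
  rw [norm_div, norm_pow, Complex.norm_natCast]
  -- The empty word contributes 1/0 = 0.
  rcases Nat.eq_zero_or_pos l.length with h0 | h0
  · simp [h0]
  · exact div_le_self (by positivity) (by exact_mod_cast h0)

theorem hasSum_pow_succ_div {z : ℂ} (hz : ‖z‖ < 1) :
    HasSum (fun n : ℕ => z ^ (n + 1) / ((n + 1 : ℕ) : ℂ)) (-Complex.log (1 - z)) := by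
  have := (hasSum_nat_add_iff' 1).2 (Complex.hasSum_taylorSeries_neg_log hz)
  simpa using this

namespace SerreGraph.RegularCovering

variable {G : Type*} [CommGroup G] [IsMulTorsionFree G] {X Y : SerreGraph} [MulAction G Y.V]
  [MulAction G Y.Dart] [IsGraphAction G Y] (p : RegularCovering G Y X) (s : X.V → Y.V)
  (hs : ∀ a, p.onV (s a) = a)

/-- The Euler product over the orbits of primitive classes is the exponential of a sum over the
closed reduced words of the base with trivial monodromy. -/
theorem hasProd_eulerFactor [Fintype X.Dart] {u : ℂ} (hu : ‖u‖ < 1)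
    (hd : Fintype.card X.Dart * ‖u‖ < 1) :
    HasProd (eulerFactor G Y u)
      (Complex.exp (-∑' l : p.words s hs, u ^ l.1.length / (l.1.length : ℂ))) := by
  have hsum : Summable fun l : p.words s hs => u ^ l.1.length / (l.1.length : ℂ) :=
    ((summable_pow_length_div hd).of_norm).subtype _
  set S := ∑' l : p.words s hs, u ^ l.1.length / (l.1.length : ℂ) with hS
  -- Split each word into primitive root and exponent.
  have h1 : HasSum (fun rk : p.primitiveWords s hs × ℕ =>
      u ^ ((rk.2 + 1) * rk.1.1.length) / (((rk.2 + 1) * rk.1.1.length : ℕ) : ℂ)) S := by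
    have h2 := ((p.wordsEquiv s hs).hasSum_iff).2 hsum.hasSum
    convert! h2 using 2 with rk
    simp only [Function.comp, p.length_wordsEquiv s hs rk.1 rk.2]
  have hpos : ∀ r : p.primitiveWords s hs, r.1.length ≠ 0 := fun r => by
    simpa using r.2.1.1
  have hlt : ∀ n : ℕ, n ≠ 0 → ‖u ^ n‖ < 1 := fun n hn => by
    rw [norm_pow]
    exact pow_lt_one₀ (norm_nonneg _) hu hn
  -- Summing over the exponent gives the Taylor series of the logarithm.
  have h2 : HasSum (fun r : p.primitiveWords s hs =>
      -Complex.log (1 - u ^ r.1.length) / (r.1.length : ℂ)) S := by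
    refine h1.prod_fiberwise fun r => ?_
    have h3 := (hasSum_pow_succ_div (hlt _ (hpos r))).div_const (r.1.length : ℂ)
    convert! h3 using 2 with k
    rw [div_div, ← pow_mul, mul_comm r.1.length]
    push_cast
    ring
  -- Each orbit collects `orbitLen c` equal terms, cancelling the denominator.
  have h3 : HasSum (fun c : MulAction.orbitRel.Quotient G Y.PrimitiveClass =>
      -Complex.log (1 - u ^ orbitLen c)) S := by
    have h4 := ((Equiv.sigmaFiberEquiv (p.wordOrbit s hs)).hasSum_iff).2 h2
    refine h4.sigma fun c => ?_
    have hc : orbitLen c ≠ 0 := by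
      obtain ⟨r, rfl⟩ := p.wordOrbit_surjective s hs c
      rw [p.orbitLen_wordOrbit]
      exact hpos r
    have hcard := p.card_fiber s hs c
    have : Finite {r : p.primitiveWords s hs // p.wordOrbit s hs r = c} :=
      Nat.finite_of_card_ne_zero (by rw [hcard]; exact hc)
    let _ := Fintype.ofFinite {r : p.primitiveWords s hs // p.wordOrbit s hs r = c}
    convert! hasSum_fintype _ using 1
    rw [Finset.sum_congr rfl
      (g := fun _ => -Complex.log (1 - u ^ orbitLen c) / (orbitLen c : ℂ)),
      Finset.sum_const, Finset.card_univ, ← Nat.card_eq_fintype_card, hcard, nsmul_eq_mul,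
      mul_div_cancel₀]
    · exact_mod_cast hc
    · rintro ⟨r, rfl⟩ -
      simp only [Function.comp, Equiv.sigmaFiberEquiv_apply, p.orbitLen_wordOrbit]
  rw [funext (p.eulerFactor_eq u)]
  refine Complex.hasProd_of_hasSum_log (fun c => ?_) ?_
  · have hc : orbitLen c ≠ 0 := by
      obtain ⟨r, rfl⟩ := p.wordOrbit_surjective s hs c
      rw [p.orbitLen_wordOrbit]
      exact hpos r
    intro h
    have := hlt _ hc
    rw [← sub_eq_zero.1 h] at this
    simp at this
  · simpa using h3.neg

end SerreGraph.RegularCovering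

/-! ### Traces of powers, eigenvalues and closed paths of matrix entries. -/

namespace Matrix

section Eigenvalues

variable {n : Type*} [Fintype n] [DecidableEq n] (M : Matrix n n ℂ)

theorem det_sub_scalar_eq_prod_roots (b : ℂ) :
    (M - algebraMap ℂ _ b).det = (M.charpoly.roots.map fun x => x - b).prod := by
  have h1 : (algebraMap ℂ (Matrix n n ℂ) b - M).det =
      (M.charpoly.roots.map fun x => b - x).prod := by
    have h2 := congrArg (Polynomial.eval b) (IsAlgClosed.splits M.charpoly).eq_prod_roots
    rw [M.charpoly_monic.leadingCoeff, map_one, one_mul, Matrix.eval_charpoly,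
      Polynomial.eval_multiset_prod, Multiset.map_map] at h2
    simpa [Matrix.algebraMap_eq_diagonal, Pi.algebraMap_def] using h2
  rw [← neg_sub, Matrix.det_neg, h1]
  have hc : Fintype.card n = Multiset.card M.charpoly.roots := by
    rw [← M.charpoly_natDegree_eq_dim, (IsAlgClosed.splits M.charpoly).natDegree_eq_card_roots]
  rw [hc]
  generalize M.charpoly.roots = t
  induction t using Multiset.induction with
  | empty => simp
  | cons a t ih =>
    simp only [Multiset.map_cons, Multiset.prod_cons, Multiset.card_cons, ← ih]
    ring

/-- Both sides are multiplicative in `q`, which splits over ℂ, so constants and linear factors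
suffice. -/
theorem det_aeval_eq_prod_roots (q : ℂ[X]) :
    (Polynomial.aeval M q).det = (M.charpoly.roots.map fun x => q.eval x).prod := by
  let F : ℂ[X] →* ℂ := Matrix.detMonoidHom.comp (Polynomial.aeval M : ℂ[X] →ₐ[ℂ] _).toMonoidHom
  let F' : ℂ[X] →* ℂ :=
    { toFun := fun q => (M.charpoly.roots.map fun x => q.eval x).prod
      map_one' := by simp
      map_mul' := fun p q => by simp [Multiset.prod_map_mul] }
  have hc : Fintype.card n = Multiset.card M.charpoly.roots := by
    rw [← M.charpoly_natDegree_eq_dim, (IsAlgClosed.splits M.charpoly).natDegree_eq_card_roots]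
  have hC : ∀ a : ℂ, F (Polynomial.C a) = F' (Polynomial.C a) := fun a => by
    change (Polynomial.aeval M (Polynomial.C a)).det =
      (M.charpoly.roots.map fun x => (Polynomial.C a).eval x).prod
    simp [Polynomial.aeval_C, Matrix.algebraMap_eq_diagonal, Matrix.det_diagonal, hc]
  have hX : ∀ b : ℂ, F (Polynomial.X - Polynomial.C b) = F' (Polynomial.X - Polynomial.C b) :=
    fun b => by
    change (Polynomial.aeval M (Polynomial.X - Polynomial.C b)).det =
      (M.charpoly.roots.map fun x => (Polynomial.X - Polynomial.C b).eval x).prod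
    simpa using det_sub_scalar_eq_prod_roots M b
  change F q = F' q
  rw [(IsAlgClosed.splits q).eq_prod_roots, map_mul, map_mul, hC, map_multiset_prod,
    map_multiset_prod, Multiset.map_map, Multiset.map_map]
  simp only [Function.comp_def, hX]

/-- Applying `det_aeval_eq_prod_roots` to `t - X ^ m` identifies the characteristic roots of `M ^
m`, with multiplicity. -/
theorem trace_pow_eq_sum_roots (m : ℕ) :
    (M ^ m).trace = (M.charpoly.roots.map fun x => x ^ m).sum := by
  have h : (M ^ m).charpoly =
      ((M.charpoly.roots.map fun x => x ^ m).map fun a => Polynomial.X - Polynomial.C a).prod := by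
    refine Polynomial.funext fun t => ?_
    have h1 := det_aeval_eq_prod_roots M (Polynomial.C t - Polynomial.X ^ m)
    rw [Matrix.eval_charpoly, Polynomial.eval_multiset_prod, Multiset.map_map, Multiset.map_map]
    simpa [Polynomial.aeval_C, Matrix.algebraMap_eq_diagonal, Pi.algebraMap_def] using h1
  rw [Matrix.trace_eq_sum_roots_charpoly, h, Polynomial.roots_multiset_prod_X_sub_C]

/-- Gershgorin's circle theorem. -/
theorem norm_le_of_mem_roots_charpoly {x : ℂ} {C : ℝ} (hx : x ∈ M.charpoly.roots)
    (hM : ∀ i, ∑ j, ‖M i j‖ ≤ C) : ‖x‖ ≤ C := by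
  have h1 : Module.End.HasEigenvalue (Matrix.toLin' M) x := by
    rw [Module.End.hasEigenvalue_iff_isRoot_charpoly, Matrix.charpoly_toLin']
    exact (Polynomial.mem_roots'.1 hx).2
  obtain ⟨k, hk⟩ := eigenvalue_mem_ball h1
  rw [mem_closedBall_iff_norm] at hk
  calc ‖x‖ ≤ ‖M k k‖ + ‖x - M k k‖ := by
        simpa using norm_add_le (M k k) (x - M k k)
    _ ≤ ‖M k k‖ + ∑ j ∈ Finset.univ.erase k, ‖M k j‖ := by gcongr
    _ = ∑ j, ‖M k j‖ := Finset.add_sum_erase _ (fun j => ‖M k j‖) (Finset.mem_univ k)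
    _ ≤ C := hM k

/-- `L` is the sum of the principal values of -log(1 - u x), which need not be minus the principal
logarithm of the product; hence the formulation through `exp`. The term `m = 0` vanishes as a
division by zero. -/
theorem exists_hasSum_pow_div (u : ℂ) (t : Multiset ℂ) (ht : ∀ x ∈ t, ‖u * x‖ < 1) :
    ∃ L, HasSum (fun m : ℕ => u ^ m * (t.map fun x => x ^ m).sum / m) L ∧
      Complex.exp (-L) = (t.map fun x => 1 - u * x).prod := by
  induction t using Multiset.induction with
  | empty => exact ⟨0, by simp, by simp⟩
  | cons a t ih =>
    obtain ⟨L, h1, h2⟩ := ih fun x hx => ht x (Multiset.mem_cons_of_mem hx)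
    have ha := ht a (Multiset.mem_cons_self a t)
    refine ⟨-Complex.log (1 - u * a) + L, ?_, ?_⟩
    · convert! (Complex.hasSum_taylorSeries_neg_log ha).add h1 using 2 with m
      simp only [Multiset.map_cons, Multiset.sum_cons]
      ring
    · have h0 : 1 - u * a ≠ 0 := by
        intro h
        rw [← sub_eq_zero.1 h] at ha
        simp at ha
      rw [Multiset.map_cons, Multiset.prod_cons, ← h2, neg_add, neg_neg, Complex.exp_add,
        Complex.exp_log h0]

theorem exists_hasSum_trace_pow {u : ℂ} {C : ℝ} (hM : ∀ i, ∑ j, ‖M i j‖ ≤ C)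
    (hu : C * ‖u‖ < 1) : ∃ L, HasSum (fun m : ℕ => u ^ m * (M ^ m).trace / m) L ∧
      Complex.exp (-L) = (1 - u • M).det := by
  obtain ⟨L, h1, h2⟩ := exists_hasSum_pow_div u M.charpoly.roots fun x hx => by
    rw [norm_mul]
    have := mul_le_mul_of_nonneg_right (norm_le_of_mem_roots_charpoly M hx hM) (norm_nonneg u)
    linarith
  refine ⟨L, by simpa only [trace_pow_eq_sum_roots] using h1, ?_⟩
  rw [h2]
  have h3 := det_aeval_eq_prod_roots M (1 - Polynomial.C u * Polynomial.X)
  simp only [map_sub, map_one, map_mul, Polynomial.aeval_C, Polynomial.aeval_X,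
    Polynomial.eval_sub, Polynomial.eval_one, Polynomial.eval_mul, Polynomial.eval_C,
    Polynomial.eval_X, ← Algebra.smul_def] at h3
  exact h3.symm

end Eigenvalues

section Paths

variable {n R : Type*} [Fintype n] [DecidableEq n] [CommSemiring R] (M : Matrix n n R)

/-- The product of matrix entries along a path. -/
def pathWeight : n → List n → n → R
  | i, [], j => M i j
  | i, k :: l, j => M i k * pathWeight k l j

/-- The product of matrix entries along a closed path. -/
def cycleWeight : List n → R
  | [] => 0
  | i :: l => M.pathWeight i l i

/-- Splitting off the first entry of a list of given length. -/
noncomputable def _root_.List.consLengthEquiv (α : Type*) (m : ℕ) :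
    α × {l : List α // l.length = m} ≃ {l : List α // l.length = m + 1} :=
  Equiv.ofBijective (fun x => ⟨x.1 :: x.2.1, by simp [x.2.2]⟩) <| by
    constructor
    · rintro ⟨a, l, hl⟩ ⟨b, l', hl'⟩ h
      simp at h
      simp [h]
    · rintro ⟨l, hl⟩
      rcases l with _ | ⟨a, l⟩
      · simp at hl
      · exact ⟨(a, ⟨l, by simpa using hl⟩), rfl⟩

instance _root_.List.fintypeLength (m : ℕ) : Fintype {l : List n // l.length = m} :=
  inferInstanceAs (Fintype (List.Vector n m))

theorem pow_succ_apply_eq_sum_pathWeight (m : ℕ) (i j : n) :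
    (M ^ (m + 1)) i j = ∑ l : {l : List n // l.length = m}, M.pathWeight i l.1 j := by
  induction m generalizing i with
  | zero =>
    rw [Fintype.sum_eq_single (⟨[], rfl⟩ : {l : List n // l.length = 0})]
    · simp [pathWeight]
    · rintro ⟨l, hl⟩ h
      exact absurd (Subtype.ext (List.length_eq_zero_iff.1 hl)) h
  | succ m ih =>
    rw [pow_succ', Matrix.mul_apply, ← (List.consLengthEquiv n m).sum_comp, Fintype.sum_prod_type]
    refine Finset.sum_congr rfl fun k _ => ?_
    rw [ih, Finset.mul_sum]
    rfl

theorem trace_pow_succ_eq_sum_cycleWeight (m : ℕ) :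
    (M ^ (m + 1)).trace = ∑ l : {l : List n // l.length = m + 1}, M.cycleWeight l.1 := by
  rw [← (List.consLengthEquiv n m).sum_comp, Fintype.sum_prod_type, Matrix.trace]
  exact Finset.sum_congr rfl fun i _ => M.pow_succ_apply_eq_sum_pathWeight m i i

end Paths

end Matrix

/-! ### The weighted Ihara–Bass formula. -/

namespace SerreGraph

section Weighted

variable (X : SerreGraph) [Fintype X.V] [DecidableEq X.V] [Fintype X.Dart] [DecidableEq X.Dart]
  {K : Type*} [CommRing K] (ψ : X.Dart → K)

open Classical in
/-- The weighted edge matrix: the transitions of paths without backtracking. -/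
noncomputable def edgeMatrix : Matrix X.Dart X.Dart K :=
  Matrix.of fun e f => if X.FollowsReduced e f then ψ e else 0

/-- The weighted adjacency matrix. -/
def weightedAdjacency : Matrix X.V X.V K :=
  Matrix.of fun a b => ∑ e, if X.src e = a ∧ X.tgt e = b then ψ e else 0

/-- The number of darts at a vertex, as a diagonal matrix. -/
def degreeMatrix (K : Type*) [CommRing K] : Matrix X.V X.V K :=
  Matrix.diagonal fun a => ∑ e, if X.src e = a then 1 else 0

/-- The weighted reversal of darts. -/
def reversalMatrix : Matrix X.Dart X.Dart K :=
  Matrix.of fun e f => if f = X.inv e then ψ e else 0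

/-- The incidence matrix of vertices and darts starting there. -/
def sourceMatrix (K : Type*) [CommRing K] : Matrix X.V X.Dart K :=
  Matrix.of fun a e => if X.src e = a then 1 else 0

/-- The weighted incidence matrix of darts and the vertices where they end. -/
def targetMatrix : Matrix X.Dart X.V K := Matrix.of fun e a => if X.tgt e = a then ψ e else 0

/-- The product allows every dart starting where `e` ends; the reversal matrix removes the single
backtracking. -/
theorem edgeMatrix_eq :
    X.edgeMatrix ψ = X.targetMatrix ψ * X.sourceMatrix K - X.reversalMatrix ψ := by
  ext e f
  simp only [edgeMatrix, targetMatrix, sourceMatrix, reversalMatrix, Matrix.sub_apply,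
    Matrix.mul_apply, Matrix.of_apply, FollowsReduced, mul_ite, mul_one,
    mul_zero, Finset.sum_ite_eq, Finset.mem_univ, if_true]
  by_cases h : f = X.inv e
  · have : X.tgt e = X.src f := by rw [h, tgt]
    simp [h, tgt]
  · by_cases h' : X.tgt e = X.src f
    · simp [h, h']
    · simp [h, h']

theorem sourceMatrix_mul_targetMatrix :
    X.sourceMatrix K * X.targetMatrix ψ = X.weightedAdjacency ψ := by
  ext a b
  simp only [targetMatrix, sourceMatrix, weightedAdjacency, Matrix.mul_apply, Matrix.of_apply,
    ite_mul, zero_mul, one_mul, ← ite_and]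

variable {ψ} (hψ : ∀ e, ψ e * ψ (X.inv e) = 1)

include hψ in
theorem reversalMatrix_mul_self : X.reversalMatrix ψ * X.reversalMatrix ψ = 1 := by
  ext e f
  rw [Matrix.mul_apply, Finset.sum_eq_single (X.inv e)]
  · simp [reversalMatrix, X.inv_inv, Matrix.one_apply, hψ, eq_comm]
  · intro g _ hg
    simp [reversalMatrix, hg]
  · simp

include hψ in
theorem sourceMatrix_mul_reversalMatrix_mul_targetMatrix :
    X.sourceMatrix K * (X.reversalMatrix ψ * X.targetMatrix ψ) = X.degreeMatrix K := by
  ext a b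
  simp only [reversalMatrix, targetMatrix, sourceMatrix, degreeMatrix, Matrix.mul_apply,
    Matrix.of_apply, ite_mul, zero_mul, one_mul, mul_ite, mul_zero, Finset.sum_ite_eq',
    Finset.mem_univ, if_true, tgt, X.inv_inv, hψ]
  by_cases h : a = b
  · subst h
    rw [Matrix.diagonal_apply_eq]
    exact Finset.sum_congr rfl fun e _ => by split_ifs <;> rfl
  · rw [Matrix.diagonal_apply_ne _ h]
    refine Finset.sum_eq_zero fun e _ => ?_
    split_ifs with h1 h2
    · exact absurd (h2.symm.trans h1) h
    · rfl
    · rfl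

/-- One dart of every geometric edge. -/
def positiveDarts : Set X.Dart := {e | (X.letter e).2 = true}

/-- Every dart is a positive dart or the reverse of one. -/
noncomputable def dartEquiv : X.positiveDarts ⊕ X.positiveDarts ≃ X.Dart :=
  Equiv.ofBijective (Sum.elim (fun e => e.1) (fun e => X.inv e.1)) <| by
    constructor
    · rintro (⟨e, he⟩ | ⟨e, he⟩) (⟨f, hf⟩ | ⟨f, hf⟩) h <;>
        simp only [positiveDarts, Set.mem_ofPred_eq] at he hf <;>
        simp only [Sum.elim_inl, Sum.elim_inr] at h
      · simp [h]
      · simp [h, letter_inv, hf] at he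
      · simp [← h, letter_inv, he] at hf
      · have := congrArg X.inv h
        simp only [X.inv_inv] at this
        simp [this]
    · intro e
      cases h : (X.letter e).2
      · exact ⟨Sum.inr ⟨X.inv e, by simp [positiveDarts, letter_inv, h]⟩, by simp [X.inv_inv]⟩
      · exact ⟨Sum.inl ⟨e, h⟩, rfl⟩

theorem card_positiveDarts : Nat.card X.positiveDarts = X.edges.ncard := by
  refine Nat.card_congr (Equiv.ofBijective
    (fun e => (⟨s(e.1, X.inv e.1), e.1, rfl⟩ : X.edges)) ⟨?_, ?_⟩)
  · rintro ⟨e, he⟩ ⟨f, hf⟩ h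
    have h1 : (X.letter e).1 = (X.letter f).1 := congrArg Subtype.val h
    have h2 : X.letter e = X.letter f := Prod.ext h1 (Eq.trans he (Eq.symm hf))
    exact Subtype.ext (X.letter_injective h2)
  · rintro ⟨_, e, rfl⟩
    cases h : (X.letter e).2
    · exact ⟨⟨X.inv e, by simp [positiveDarts, letter_inv, h]⟩, Subtype.ext (X.sym2_inv e)⟩
    · exact ⟨⟨e, h⟩, rfl⟩

theorem card_dart : Fintype.card X.Dart = X.edges.ncard + X.edges.ncard := by
  rw [← Nat.card_eq_fintype_card, ← Nat.card_congr X.dartEquiv, Nat.card_sum,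
    card_positiveDarts]

include hψ in
-- The matrix decouples into one 2×2 block per geometric edge, with off-diagonal entries u ψ(e) and
-- u ψ(ē) of product u².
theorem det_one_add_reversalMatrix (u : K) :
    (1 + u • X.reversalMatrix ψ).det = (1 - u ^ 2) ^ X.edges.ncard := by
  classical
  rw [← Matrix.det_submatrix_equiv_self X.dartEquiv]
  have h : (1 + u • X.reversalMatrix ψ).submatrix X.dartEquiv X.dartEquiv =
      Matrix.fromBlocks 1 (Matrix.diagonal fun e : X.positiveDarts => u * ψ e.1)
        (Matrix.diagonal fun e : X.positiveDarts => u * ψ (X.inv e.1)) 1 := by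
    have hne : ∀ e f : X.positiveDarts, e.1 ≠ X.inv f.1 := fun e f h => by
      have he := e.2
      have hf := f.2
      simp only [positiveDarts, Set.mem_ofPred_eq] at he hf
      simp [h, letter_inv, hf] at he
    have hinj : ∀ e f : X.positiveDarts, X.inv e.1 = X.inv f.1 ↔ e = f := fun e f =>
      ⟨fun h => Subtype.ext (by rw [← X.inv_inv e.1, h, X.inv_inv]), fun h => by rw [h]⟩
    have hl : ∀ e, X.dartEquiv (Sum.inl e) = e.1 := fun _ => rfl
    have hr : ∀ e, X.dartEquiv (Sum.inr e) = X.inv e.1 := fun _ => rfl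
    ext (e | e) (f | f)
    · simp [hl, reversalMatrix, hne, Matrix.one_apply, Subtype.ext_iff]
    · simp [hl, hr, reversalMatrix, hne, hinj, Matrix.diagonal_apply, eq_comm]
    · simp [hl, hr, reversalMatrix, X.inv_inv, (hne _ _).symm,
        Matrix.diagonal_apply, Subtype.ext_iff, eq_comm]
    · simp [hr, reversalMatrix, X.inv_inv, Matrix.one_apply, (hne _ _).symm, hinj]
  rw [h, Matrix.det_fromBlocks_one₁₁, Matrix.diagonal_mul_diagonal, ← Matrix.diagonal_one,
    Matrix.diagonal_sub, Matrix.det_diagonal, Finset.prod_congr rfl (g := fun _ => 1 - u ^ 2),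
    Finset.prod_const, Finset.card_univ, ← Nat.card_eq_fintype_card, card_positiveDarts]
  intro e _
  linear_combination (-u ^ 2) * hψ e.1

/-- The Ihara–Bass formula for a weighted graph. -/
theorem det_one_sub_edgeMatrix {K : Type*} [Field K] {ψ : X.Dart → K}
    (hψ : ∀ e, ψ e * ψ (X.inv e) = 1) {u : K} (hu : 1 - u ^ 2 ≠ 0) :
    (1 - u • X.edgeMatrix ψ).det * (1 - u ^ 2) ^ Fintype.card X.V =
      (1 - u ^ 2) ^ X.edges.ncard *
        (1 - u • X.weightedAdjacency ψ + u ^ 2 • (X.degreeMatrix K - 1)).det := by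
  set c := 1 - u ^ 2 with hc
  set J := X.reversalMatrix ψ
  set S := X.sourceMatrix K
  set T := X.targetMatrix ψ
  have hJ : J * J = 1 := X.reversalMatrix_mul_self hψ
  have hdet : (1 - u • J).det = c ^ X.edges.ncard := by
    have := X.det_one_add_reversalMatrix hψ (-u)
    rwa [neg_smul, ← sub_eq_add_neg, neg_sq] at this
  -- Since `J` is an involution, (1 - uJ)(1 + uJ) = c; multiplying by 1 - uJ leaves a scalar minus a
  -- product factoring through the vertices.
  have h1 : (1 - u • J) * (1 - u • X.edgeMatrix ψ) =
      c • (1 - ((u / c) • ((1 - u • J) * T)) * S) := by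
    have h2 : (1 - u • J) * (1 + u • J) = c • 1 := by
      rw [Matrix.mul_add, Matrix.mul_one, Matrix.sub_mul, Matrix.one_mul, Matrix.smul_mul,
        Matrix.mul_smul, hJ, smul_smul, hc, sub_smul, one_smul, pow_two]
      abel
    have h3 : 1 - u • X.edgeMatrix ψ = 1 + u • J - u • (T * S) := by
      rw [X.edgeMatrix_eq, smul_sub]
      abel
    rw [h3, Matrix.mul_sub, h2, smul_sub, Matrix.smul_mul, smul_smul, mul_div_cancel₀ _ hu,
      Matrix.mul_smul, Matrix.mul_assoc]
  -- Sylvester's identity det(1 - AB) = det(1 - BA) passes from darts to vertices; `card_dart`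
  -- splits the power of `c` into two equal parts.
  have h2 : (1 - u • X.edgeMatrix ψ).det * c ^ X.edges.ncard =
      c ^ X.edges.ncard * (c ^ X.edges.ncard *
        (1 - S * ((u / c) • ((1 - u • J) * T))).det) := by
    rw [← hdet, mul_comm, ← Matrix.det_mul, h1, Matrix.det_smul, Matrix.det_one_sub_mul_comm,
      hdet, ← mul_assoc, ← pow_add, X.card_dart]
  -- Here S T is the adjacency matrix and S J T the degree matrix.
  have h3 : c • (1 - S * ((u / c) • ((1 - u • J) * T))) =
      1 - u • X.weightedAdjacency ψ + u ^ 2 • (X.degreeMatrix K - 1) := by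
    rw [Matrix.mul_smul, smul_sub, smul_smul, mul_div_cancel₀ _ hu, Matrix.sub_mul, Matrix.mul_sub,
      Matrix.one_mul, X.sourceMatrix_mul_targetMatrix, Matrix.smul_mul, Matrix.mul_smul,
      X.sourceMatrix_mul_reversalMatrix_mul_targetMatrix hψ]
    rw [hc, sub_smul, one_smul, smul_sub, smul_sub, smul_smul, pow_two]
    abel
  rw [← h3, Matrix.det_smul]
  have hc0 : c ^ X.edges.ncard ≠ 0 := pow_ne_zero _ hu
  apply mul_right_cancel₀ hc0
  linear_combination (c ^ Fintype.card X.V) * h2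

end Weighted

/-! ### The edge determinant as a sum over closed reduced words. -/

section Words

variable (X : SerreGraph) [DecidableEq X.V] [Fintype X.Dart] [DecidableEq X.Dart] (ψ : X.Dart → ℂ)

/-- The closed reduced cyclic words. -/
def closedWords : Set (List X.Dart) :=
  {r | r ≠ [] ∧ Cycle.Chain X.FollowsReduced (r : Cycle X.Dart)}

open Classical in
theorem pathWeight_edgeMatrix (l : List X.Dart) (e f : X.Dart) :
    (X.edgeMatrix ψ).pathWeight e l f =
      if List.IsChain X.FollowsReduced (e :: (l ++ [f])) then ψ e * (l.map ψ).prod else 0 := by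
  induction l generalizing e with
  | nil => simp [Matrix.pathWeight, edgeMatrix]
  | cons a l ih =>
    rw [Matrix.pathWeight, ih]
    simp only [List.cons_append, List.isChain_cons_cons]
    by_cases h1 : X.FollowsReduced e a <;>
      by_cases h2 : List.IsChain X.FollowsReduced (a :: (l ++ [f])) <;>
      simp [edgeMatrix, h1, h2]

open Classical in
theorem cycleWeight_edgeMatrix (l : List X.Dart) :
    (X.edgeMatrix ψ).cycleWeight l = if l ∈ X.closedWords then (l.map ψ).prod else 0 := by
  rcases l with _ | ⟨e, l⟩
  · simp [Matrix.cycleWeight, closedWords]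
  · rw [Matrix.cycleWeight, pathWeight_edgeMatrix]
    simp [closedWords, Cycle.chain_coe_cons]

/-- The determinant of the edge matrix as exponential of a sum over closed reduced words. -/
theorem exp_neg_tsum_closedWords (hψ : ∀ e, ‖ψ e‖ ≤ 1) {u : ℂ}
    (hu : Fintype.card X.Dart * ‖u‖ < 1) :
    Summable (fun l : X.closedWords => ‖u ^ l.1.length / (l.1.length : ℂ) * (l.1.map ψ).prod‖) ∧
    Complex.exp (-∑' l : X.closedWords, u ^ l.1.length / (l.1.length : ℂ) * (l.1.map ψ).prod) =
      (1 - u • X.edgeMatrix ψ).det := by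
  classical
  have hprod : ∀ l : List X.Dart, ‖(l.map ψ).prod‖ ≤ 1 := by
    intro l
    induction l with
    | nil => simp
    | cons a l ih =>
      rw [List.map_cons, List.prod_cons, norm_mul]
      exact mul_le_one₀ (hψ a) (norm_nonneg _) ih
  have hsum : Summable fun l : List X.Dart => ‖u ^ l.length / (l.length : ℂ) * (l.map ψ).prod‖ := by
    refine Summable.of_nonneg_of_le (fun _ => norm_nonneg _) (fun l => ?_)
      (summable_pow_length_div hu)
    rw [norm_mul]
    exact mul_le_of_le_one_right (norm_nonneg _) (hprod l)
  refine ⟨hsum.subtype _, ?_⟩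
  -- Entries have norm at most 1, so row sums are at most the number of darts.
  obtain ⟨L, hL, hexp⟩ := (X.edgeMatrix ψ).exists_hasSum_trace_pow (u := u)
    (C := Fintype.card X.Dart) (fun e => by
      refine (Finset.sum_le_sum (g := fun _ => (1 : ℝ)) fun f _ => ?_).trans (by simp)
      simp only [edgeMatrix, Matrix.of_apply]
      split_ifs
      · exact hψ e
      · simp) hu
  rw [← hexp]
  congr 2
  set S := ∑' l : X.closedWords, u ^ l.1.length / (l.1.length : ℂ) * (l.1.map ψ).prod with hS
  have h1 : HasSum (fun l : List X.Dart =>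
      u ^ l.length / (l.length : ℂ) * (X.edgeMatrix ψ).cycleWeight l) S := by
    have h2 := (hasSum_subtype_iff_indicator (s := X.closedWords)).1
      (hsum.of_norm.subtype X.closedWords).hasSum
    convert! h2 using 2 with l
    rw [cycleWeight_edgeMatrix, Set.indicator_apply]
    split_ifs <;> simp
  -- Grouped by length `m`, the cycle weights add up to the trace of the `m`-th power. For `m = 0`
  -- both sides vanish through division by zero.
  have h3 := ((Equiv.sigmaFiberEquiv (List.length (α := X.Dart))).hasSum_iff).2 h1
  refine (h3.sigma (g := fun m : ℕ => u ^ m * ((X.edgeMatrix ψ) ^ m).trace / m)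
    fun m => ?_).unique hL
  convert! hasSum_fintype _ using 1
  rcases m with _ | m
  · symm
    simp only [Nat.cast_zero, div_zero]
    refine Finset.sum_eq_zero fun l _ => ?_
    have : l.1.length = 0 := l.2
    simp [this]
  · rw [Matrix.trace_pow_succ_eq_sum_cycleWeight, mul_div_right_comm, Finset.mul_sum]
    refine Finset.sum_congr rfl ?_
    rintro ⟨l, hl⟩ -
    simp [hl]

end Words

end SerreGraph

/-! ### The inverse Joukowski map. -/

theorem principalSqrt_sq (z : ℂ) : principalSqrt z ^ 2 = z := by
  rw [principalSqrt, one_div]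
  exact_mod_cast Complex.cpow_nat_inv_pow z two_ne_zero

/-- This is Re(a b̄) for the two roots: their real parts are nonnegative, and their imaginary parts
have compatible signs because r + 1 and r - 1 have the same imaginary part. It gives |a - b| ≤ |a +
b|. -/
theorem principalSqrt_mul_conj_nonneg (r : ℂ) :
    0 ≤ (principalSqrt (r + 1)).re * (principalSqrt (r - 1)).re +
      (principalSqrt (r + 1)).im * (principalSqrt (r - 1)).im := by
  have h1 : ∀ z : ℂ, 0 ≤ (principalSqrt z).re := fun z => by
    rw [principalSqrt, one_div, Complex.cpow_inv_two_re]
    positivity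
  have h2 : 0 ≤ (principalSqrt (r + 1)).im * (principalSqrt (r - 1)).im := by
    simp only [principalSqrt, one_div]
    rcases le_or_gt 0 r.im with h | h
    · rw [Complex.cpow_inv_two_im_eq_sqrt (by simpa using h),
        Complex.cpow_inv_two_im_eq_sqrt (by simpa using h)]
      positivity
    · rw [Complex.cpow_inv_two_im_eq_neg_sqrt (by simpa using h),
        Complex.cpow_inv_two_im_eq_neg_sqrt (by simpa using h), neg_mul_neg]
      positivity
  have := mul_nonneg (h1 (r + 1)) (h1 (r - 1))
  linarith

/-- The inverse Joukowski map in terms of principal square roots. -/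
theorem joukowski_inverse (r : ℂ) :
    (r + principalSqrt (r + 1) * principalSqrt (r - 1)) ≠ 0 ∧
    (r + principalSqrt (r + 1) * principalSqrt (r - 1)) +
      (r + principalSqrt (r + 1) * principalSqrt (r - 1))⁻¹ = 2 * r ∧
    1 ≤ ‖r + principalSqrt (r + 1) * principalSqrt (r - 1)‖ := by
  set a := principalSqrt (r + 1) with ha
  set b := principalSqrt (r - 1) with hb
  have ha2 : a ^ 2 = r + 1 := principalSqrt_sq _
  have hb2 : b ^ 2 = r - 1 := principalSqrt_sq _
  have hmul : (r + a * b) * (r - a * b) = 1 := by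
    linear_combination (-b ^ 2) * ha2 - (r + 1) * hb2
  have h0 : r + a * b ≠ 0 := left_ne_zero_of_mul_eq_one hmul
  have hinv : (r + a * b)⁻¹ = r - a * b := inv_eq_of_mul_eq_one_right hmul
  refine ⟨h0, by rw [hinv]; ring, ?_⟩
  -- The mutually inverse numbers r ± ab are half the squares of a ± b, so comparing |a + b| with |a
  -- - b| decides which one has norm at least 1.
  have h1 : (a + b) ^ 2 = 2 * (r + a * b) := by linear_combination ha2 + hb2
  have h2 : (a - b) ^ 2 = 2 * (r - a * b) := by linear_combination ha2 + hb2
  have h3 : ‖a - b‖ ^ 2 ≤ ‖a + b‖ ^ 2 := by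
    have := principalSqrt_mul_conj_nonneg r
    rw [← Complex.normSq_eq_norm_sq, ← Complex.normSq_eq_norm_sq, Complex.normSq_apply,
      Complex.normSq_apply, Complex.add_re, Complex.add_im, Complex.sub_re, Complex.sub_im]
    nlinarith
  rw [← norm_pow, ← norm_pow, h1, h2, norm_mul, norm_mul] at h3
  have h4 : ‖r - a * b‖ ≤ ‖r + a * b‖ := by
    have : (0 : ℝ) < ‖(2 : ℂ)‖ := by simp
    exact le_of_mul_le_mul_left h3 this
  have h5 : ‖r + a * b‖ * ‖r - a * b‖ = 1 := by rw [← norm_mul, hmul, norm_one]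
  by_contra h6
  push Not at h6
  nlinarith [norm_nonneg (r + a * b), norm_nonneg (r - a * b)]

theorem one_lt_norm_joukowski_inverse {r : ℂ} (h : ∀ z : ℂ, ‖z‖ = 1 → r ≠ (z + z⁻¹) / 2) :
    1 < ‖r + principalSqrt (r + 1) * principalSqrt (r - 1)‖ := by
  obtain ⟨-, h2, h3⟩ := joukowski_inverse r
  refine lt_of_le_of_ne h3 fun h4 => h _ h4.symm ?_
  rw [h2]
  ring

theorem exists_add_inv_div_two (x : ℂ) : ∃ z : ℂ, z ≠ 0 ∧ (z + z⁻¹) / 2 = x := by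
  obtain ⟨h1, h2, -⟩ := joukowski_inverse x
  exact ⟨_, h1, by rw [h2]; ring⟩

/-! ### Extracting the constant Fourier coefficient. -/

section Averages

open Metric

theorem diffContOnCl_tsum_mul_pow {ι : Type*} {a : ι → ℂ} (ha : Summable fun i => ‖a i‖)
    (n : ι → ℕ) : DiffContOnCl ℂ (fun z : ℂ => ∑' i, a i * z ^ n i) (ball 0 1) := by
  have hb : ∀ i, ∀ z : ℂ, ‖z‖ ≤ 1 → ‖a i * z ^ n i‖ ≤ ‖a i‖ := fun i z hz => by
    rw [norm_mul, norm_pow]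
    exact mul_le_of_le_one_right (norm_nonneg _) (pow_le_one₀ (norm_nonneg _) hz)
  constructor
  · refine Complex.differentiableOn_tsum_of_summable_norm ha (fun i => by fun_prop) isOpen_ball ?_
    intro i w hw
    exact hb i w (mem_ball_zero_iff.1 hw).le
  · refine continuousOn_tsum (fun i => by fun_prop) ha ?_
    intro i w hw
    rw [closure_ball _ one_ne_zero] at hw
    exact hb i w (mem_closedBall_zero_iff.1 hw)

/-- Uniqueness of the constant factor in a Wiener–Hopf factorization on the unit circle. -/
theorem eq_exp_of_factorization {ι : Type*} {c : ι → ℂ} (hc : Summable fun i => ‖c i‖) (k : ι → ℤ)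
    {n : ℕ} {w : Fin n → ℂ} (hw : ∀ i, 1 < ‖w i‖) {C : ℂ}
    (h : ∀ z : ℂ, ‖z‖ = 1 → C * (∏ i, (1 - z / w i)) * ∏ i, (1 - z⁻¹ / w i) =
      Complex.exp (∑' i, c i * z ^ k i)) :
    C = Complex.exp (∑' i, if k i = 0 then c i else 0) := by
  have hle : ∀ (p : ι → Prop) [DecidablePred p], Summable fun i => ‖if p i then c i else 0‖ :=
    fun p _ => Summable.of_nonneg_of_le (fun _ => norm_nonneg _)
      (fun i => by split_ifs <;> simp) hc
  set A : ℂ → ℂ := fun z => ∏ i, (1 - z / w i) with hA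
  set g₀ := ∑' i, if k i = 0 then c i else 0
  set gp : ℂ → ℂ := fun z => ∑' i, (if 0 < k i then c i else 0) * z ^ (k i).toNat with hgp
  set gm : ℂ → ℂ := fun z => ∑' i, (if k i < 0 then c i else 0) * z ^ (-k i).toNat with hgm
  have hgp' : DiffContOnCl ℂ gp (ball 0 1) := diffContOnCl_tsum_mul_pow (hle _) _
  have hgm' : DiffContOnCl ℂ gm (ball 0 1) := diffContOnCl_tsum_mul_pow (hle _) _
  have hAd : DiffContOnCl ℂ A (ball 0 1) := by
    refine Differentiable.diffContOnCl ?_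
    simp only [hA]
    fun_prop
  have hA0 : ∀ z : ℂ, ‖z‖ ≤ 1 → A z ≠ 0 := fun z hz => by
    refine Finset.prod_ne_zero_iff.2 fun i _ h0 => ?_
    have h1 : z / w i = 1 := (sub_eq_zero.1 h0).symm
    have h2 : w i ≠ 0 := by
      intro h3
      have := hw i
      simp [h3] at this
      linarith
    rw [div_eq_one_iff_eq h2] at h1
    rw [h1] at hz
    exact absurd (hw i) (not_lt.2 hz)
  -- Constant, positive and negative Fourier parts; `gp` and `gm` are both holomorphic in the disc
  -- and vanish at 0.
  have hsplit : ∀ z : ℂ, ‖z‖ = 1 → ∑' i, c i * z ^ k i = g₀ + gp z + gm z⁻¹ := by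
    intro z hz
    have hb : ∀ (p : ι → Prop) [DecidablePred p] (m : ι → ℕ) (y : ℂ), ‖y‖ = 1 →
        Summable fun i => (if p i then c i else 0) * y ^ m i := fun p _ m y hy => by
      refine Summable.of_norm ((hle p).congr fun i => ?_)
      rw [norm_mul, norm_pow, hy, one_pow, mul_one]
    rw [← Summable.tsum_add (hle _).of_norm (hb _ _ z hz), ← Summable.tsum_add
      ((hle _).of_norm.add (hb _ _ z hz)) (hb _ _ z⁻¹ (by rw [norm_inv, hz, inv_one]))]
    refine tsum_congr fun i => ?_
    rcases lt_trichotomy (k i) 0 with hi | hi | hi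
    · rw [if_neg hi.ne, if_neg hi.not_gt, if_pos hi, inv_pow, ← zpow_natCast z (-k i).toNat,
        ← zpow_neg, Int.toNat_of_nonneg (by omega)]
      simp
    · simp [hi]
    · rw [if_neg hi.ne', if_pos hi, if_neg hi.not_gt, ← zpow_natCast,
        Int.toNat_of_nonneg hi.le]
      simp
  have hp0 : gp 0 = 0 := by
    refine (tsum_congr fun i => ?_).trans tsum_zero
    split_ifs with hi
    · rw [zero_pow (by omega), mul_zero]
    · rw [zero_mul]
  have hm0 : gm 0 = 0 := by
    refine (tsum_congr fun i => ?_).trans tsum_zero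
    split_ifs with hi
    · rw [zero_pow (by omega), mul_zero]
    · rw [zero_mul]
  have hA1 : A 0 = 1 := by simp [hA]
  -- The factorization is rearranged on the circle to f₁(z) = f₂(z⁻¹), with both functions
  -- holomorphic in the disc; all zeros of `A` lie outside it.
  set f₁ : ℂ → ℂ := fun z => C • (A z • Complex.exp (-gp z)) with hf₁
  set f₂ : ℂ → ℂ := fun z => Complex.exp g₀ • (Complex.exp (gm z) • (A z)⁻¹) with hf₂
  have hd₁ : DiffContOnCl ℂ f₁ (ball 0 |1|) := by
    rw [abs_one]
    exact (hAd.smul (Complex.differentiable_exp.comp_diffContOnCl hgp'.neg)).const_smul C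
  have hd₂ : DiffContOnCl ℂ f₂ (ball 0 |1|) := by
    rw [abs_one]
    refine DiffContOnCl.const_smul
      (f := fun z => Complex.exp (gm z) • (A z)⁻¹)
      ((Complex.differentiable_exp.comp_diffContOnCl hgm').smul (hAd.inv ?_)) (Complex.exp g₀)
    intro z hz
    rw [closure_ball _ one_ne_zero] at hz
    exact hA0 z (mem_closedBall_zero_iff.1 hz)
  -- Circle averages are invariant under inversion, so the mean value property gives f₁(0) = f₂(0),
  -- which is the claim.
  have heq : Real.circleAverage f₁ 0 1 = Real.circleAverage (f₂ ·⁻¹) 0 1 := by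
    refine Real.circleAverage_congr_sphere fun z hz => ?_
    rw [abs_one, mem_sphere_zero_iff_norm] at hz
    have hz' : ‖z⁻¹‖ ≤ 1 := by rw [norm_inv, hz, inv_one]
    have h1 := h z hz
    rw [hsplit z hz, Complex.exp_add, Complex.exp_add] at h1
    simp only [hf₁, hf₂, smul_eq_mul, Complex.exp_neg]
    have h2 := hA0 _ hz'
    have h3 := Complex.exp_ne_zero (gp z)
    change C * A z * A z⁻¹ = _ at h1
    rw [← mul_assoc, ← mul_assoc, ← div_eq_mul_inv, ← div_eq_mul_inv, div_eq_div_iff h3 h2]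
    linear_combination h1
  rw [Real.circleAverage_zero_one_congr_inv, hd₁.circleAverage, hd₂.circleAverage] at heq
  simpa [hf₁, hf₂, hp0, hm0, hA1] using heq

end Averages

/-! ### Symmetric Laurent polynomials. -/

namespace LaurentPolynomial

variable {R : Type*} [CommRing R]

/-- The Chebyshev recursion: multiply the previous case by T + T⁻¹ and subtract the one before. -/
theorem T_add_T_neg_mem_range (n : ℕ) : (T n + T (-n) : R[T;T⁻¹]) ∈
    (Polynomial.aeval (R := R) (T 1 + T (-1) : R[T;T⁻¹])).range := by
  have h1 : (T 1 + T (-1) : R[T;T⁻¹]) ∈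
      (Polynomial.aeval (R := R) (T 1 + T (-1) : R[T;T⁻¹])).range :=
    ⟨Polynomial.X, Polynomial.aeval_X _⟩
  induction n using Nat.twoStepInduction with
  | zero =>
    simp only [Nat.cast_zero, neg_zero, T_zero]
    exact add_mem (one_mem _) (one_mem _)
  | one => simpa using h1
  | more n ih0 ih1 =>
    convert! sub_mem (mul_mem h1 ih1) ih0 using 1
    rw [add_mul, mul_add, mul_add, ← T_add, ← T_add, ← T_add, ← T_add]
    push_cast
    ring_nf

/-- A Laurent polynomial that is symmetric in `T` and `T⁻¹` is a polynomial in `T + T⁻¹`. -/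
theorem mem_range_of_invert_eq {f : R[T;T⁻¹]} (hf : invert f = f) :
    f ∈ (Polynomial.aeval (R := R) (T 1 + T (-1) : R[T;T⁻¹])).range := by
  have hC : ∀ a : R, C a ∈ (Polynomial.aeval (R := R) (T 1 + T (-1) : R[T;T⁻¹])).range :=
    fun a => ⟨Polynomial.C a, Polynomial.aeval_C _ a⟩
  -- Induction on a strict bound `N` for the absolute values of the exponents, subtracting a
  -- multiple of T^N + T^(-N).
  have key : ∀ N : ℕ, ∀ f : R[T;T⁻¹], invert f = f →
      (∀ n : ℤ, N ≤ |n| → f.coeff n = 0) →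
      f ∈ (Polynomial.aeval (R := R) (T 1 + T (-1) : R[T;T⁻¹])).range := by
    intro N
    induction N with
    | zero =>
      intro f _ h
      have : f = 0 := LaurentPolynomial.ext fun n => by simpa using h n (by simp)
      rw [this]
      exact zero_mem _
    | succ N ih =>
      intro f hf h
      have hs : ∀ n, f.coeff (-n) = f.coeff n := fun n => by
        conv_rhs => rw [← hf]
        rw [invert_apply]
      -- The constant case is separate: T^0 + T^0 = 2 need not be invertible in `R`.
      rcases Nat.eq_zero_or_pos N with rfl | hN
      · have : f = C (f.coeff 0) := LaurentPolynomial.ext fun n => by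
          rw [C_apply]
          split_ifs with hn
          · rw [hn]
          · exact h n (by simpa using Int.one_le_abs hn)
        rw [this]
        exact hC _
      · have hg := ih (f - C (f.coeff N) * (T N + T (-N))) (by simp [hf, add_comm]) (by
          intro n hn
          have hcoeff : (C (f.coeff N) * (T N + T (-N))).coeff n =
              (if (N : ℤ) = n then f.coeff N else 0) + (if -(N : ℤ) = n then f.coeff N else 0) := by
            rw [← smul_eq_C_mul]
            simp
          rw [AddMonoidAlgebra.coeff_sub, Finsupp.sub_apply, hcoeff]
          by_cases h1 : (N : ℤ) = n
          · rw [if_pos h1, if_neg (by omega), ← h1]; simp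
          by_cases h2 : -(N : ℤ) = n
          · rw [if_neg h1, if_pos h2, ← h2, hs]; simp
          · rw [if_neg h1, if_neg h2, h n]
            · simp
            · push_cast
              rcases abs_cases n with h3 | h3 <;> omega)
        have := add_mem hg (mul_mem (hC (f.coeff N)) (T_add_T_neg_mem_range N))
        simpa using this
  obtain ⟨N, hN⟩ : ∃ N : ℕ, ∀ n ∈ f.coeff.support, n.natAbs < N := by
    refine ⟨f.coeff.support.sup Int.natAbs + 1, fun n hn => ?_⟩
    exact Nat.lt_succ_of_le (Finset.le_sup hn)
  refine key N f hf fun n hn => ?_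
  by_contra h
  have := hN n (Finsupp.mem_support_iff.2 h)
  rw [Int.abs_eq_natAbs] at hn
  omega

end LaurentPolynomial

/-! ### The Laplacian in terms of the base, and existence and uniqueness of P. -/

namespace SerreGraph

open LaurentPolynomial

section

variable {X Y : SerreGraph} [Fintype X.V] [DecidableEq X.V] [Fintype X.Dart]
  [MulAction (Multiplicative ℤ) Y.V] [MulAction (Multiplicative ℤ) Y.Dart]
  [IsGraphAction (Multiplicative ℤ) Y] (p : RegularCovering (Multiplicative ℤ) Y X)
  (s : X.V → Y.V) (hs : ∀ a, p.onV (s a) = a)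

/-- The monodromy of a dart as an integer. -/
noncomputable def RegularCovering.shift (x : X.Dart) : ℤ :=
  Multiplicative.toAdd (p.monodromy s hs x)

theorem RegularCovering.shift_inv (x : X.Dart) : p.shift s hs (X.inv x) = -p.shift s hs x := by
  rw [shift, p.monodromy_inv, toAdd_inv, shift]

/-- The darts of `Y` at a chosen vertex correspond to the darts of `X`. -/
noncomputable def RegularCovering.dartsAtEquiv (a b : X.V) (k : ℤ) :
    {x : X.Dart // (X.src x = a ∧ X.tgt x = b) ∧ p.shift s hs x = k} ≃
      {e : Y.Dart // Y.src e = s a ∧ Y.tgt e = Multiplicative.ofAdd k • s b} :=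
  Equiv.ofBijective (fun x => ⟨p.lift s hs x.1, by
    obtain ⟨x, ⟨rfl, rfl⟩, rfl⟩ := x
    exact ⟨p.src_lift s hs x, p.tgt_lift s hs x⟩⟩) <| by
  constructor
  · rintro ⟨x, hx⟩ ⟨y, hy⟩ h
    have h1 := congrArg p.onDart (congrArg Subtype.val h)
    simp only [p.onDart_lift] at h1
    exact Subtype.ext h1
  · rintro ⟨e, h1, h2⟩
    have hsrc : X.src (p.onDart e) = a := by rw [← p.onV_src, h1, hs]
    have htgt : X.tgt (p.onDart e) = b := by rw [← p.onV_tgt, h2, p.onV_smul, hs]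
    have he : p.lift s hs (p.onDart e) = e :=
      p.dart_ext (p.onDart_lift s hs _) (by rw [p.src_lift, h1, hsrc])
    refine ⟨⟨p.onDart e, ⟨hsrc, htgt⟩, ?_⟩, Subtype.ext he⟩
    have h3 := p.tgt_lift s hs (p.onDart e)
    rw [he, h2, htgt] at h3
    rw [shift, ← p.smul_vertex_injective h3]
    rfl

/-- The darts of `Y` at a chosen vertex correspond to the darts of `X`. -/
noncomputable def RegularCovering.starEquiv (a : X.V) :
    {x : X.Dart // X.src x = a} ≃ {e : Y.Dart // Y.src e = s a} :=
  Equiv.ofBijective (fun x => ⟨p.lift s hs x.1, by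
    obtain ⟨x, rfl⟩ := x
    exact p.src_lift s hs x⟩) <| by
  constructor
  · rintro ⟨x, hx⟩ ⟨y, hy⟩ h
    have h1 := congrArg p.onDart (congrArg Subtype.val h)
    simp only [p.onDart_lift] at h1
    exact Subtype.ext h1
  · rintro ⟨e, h1⟩
    have hsrc : X.src (p.onDart e) = a := by rw [← p.onV_src, h1, hs]
    exact ⟨⟨p.onDart e, hsrc⟩, Subtype.ext
      (p.dart_ext (p.onDart_lift s hs _) (by rw [p.src_lift, h1, hsrc]))⟩

include p hs in
theorem RegularCovering.adjacency_eq :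
    Y.adjacency s = X.weightedAdjacency (fun x => (T (p.shift s hs x) : ℂ[T;T⁻¹])) := by
  ext a b : 1
  rw [adjacency, weightedAdjacency, Matrix.of_apply, Matrix.of_apply]
  have h1 : ∀ k : ℤ, C (Nat.card {e : Y.Dart // Y.src e = s a ∧
      Y.tgt e = Multiplicative.ofAdd k • s b} : ℂ) * T k =
      ∑ x : X.Dart, if (X.src x = a ∧ X.tgt x = b) ∧ p.shift s hs x = k
        then (T k : ℂ[T;T⁻¹]) else 0 := fun k => by
    rw [← Nat.card_congr (p.dartsAtEquiv s hs a b k), Nat.card_eq_fintype_card,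
      Fintype.card_subtype, ← Finset.sum_filter, Finset.sum_const, nsmul_eq_mul, map_natCast]
  rw [finsum_congr h1, finsum_sum_comm]
  · refine Finset.sum_congr rfl fun x _ => ?_
    rw [finsum_eq_single _ (p.shift s hs x)]
    · simp
    · intro k hk
      rw [if_neg fun h => hk h.2.symm]
  · intro x _
    refine (Set.finite_singleton (p.shift s hs x)).subset fun k hk => ?_
    by_contra h
    exact hk (if_neg fun h' => h h'.2.symm)

include p hs in
theorem RegularCovering.degree_eq (a : X.V) :
    Y.degree (s a) = ∑ x : X.Dart, if X.src x = a then 1 else 0 := by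
  rw [degree, ← Nat.card_congr (p.starEquiv s hs a), Nat.card_eq_fintype_card,
    Fintype.card_subtype, Finset.card_filter]

/-- The matrix `1 - u A + u² Q` of a weighted graph. -/
noncomputable def weightedLaplacian (X : SerreGraph) [Fintype X.V] [DecidableEq X.V]
    [Fintype X.Dart] {K : Type*} [CommRing K] (ψ : X.Dart → K) (u : K) : Matrix X.V X.V K :=
  1 - u • X.weightedAdjacency ψ + u ^ 2 • (X.degreeMatrix K - 1)

include p hs in
theorem RegularCovering.laplacian_eq (u : ℂ) : Y.laplacian s u =
    X.weightedLaplacian (fun x => (T (p.shift s hs x) : ℂ[T;T⁻¹])) (C u) := by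
  rw [laplacian, weightedLaplacian, p.adjacency_eq s hs, map_pow]
  congr 2
  rw [degreeMatrix, ← Matrix.diagonal_one, Matrix.diagonal_sub]
  congr 1
  ext1 a
  rw [p.degree_eq s hs]
  simp

theorem map_weightedLaplacian {K L : Type*} [CommRing K] [CommRing L] (f : K →+* L)
    (ψ : X.Dart → K) (u : K) : (X.weightedLaplacian ψ u).map f =
      X.weightedLaplacian (fun x => f (ψ x)) (f u) := by
  ext a b
  simp only [weightedLaplacian, weightedAdjacency, degreeMatrix, Matrix.map_apply, Matrix.add_apply,
    Matrix.sub_apply, Matrix.smul_apply, Matrix.of_apply, Matrix.diagonal_apply, Matrix.one_apply,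
    smul_eq_mul, map_add, map_sub, map_mul, map_pow, map_sum, apply_ite f, map_one, map_zero]

theorem det_map_weightedLaplacian {K L : Type*} [CommRing K] [CommRing L] (f : K →+* L)
    (ψ : X.Dart → K) (u : K) : f (X.weightedLaplacian ψ u).det =
      (X.weightedLaplacian (fun x => f (ψ x)) (f u)).det := by
  rw [RingHom.map_det, RingHom.mapMatrix_apply, map_weightedLaplacian]

theorem transpose_weightedLaplacian {K : Type*} [CommRing K] (ψ : X.Dart → K) (u : K) :
    (X.weightedLaplacian ψ u).transpose = X.weightedLaplacian (fun x => ψ (X.inv x)) u := by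
  have h : (X.weightedAdjacency ψ).transpose = X.weightedAdjacency (fun x => ψ (X.inv x)) := by
    ext a b
    simp only [weightedAdjacency, Matrix.transpose_apply, Matrix.of_apply]
    refine Finset.sum_equiv (Function.Involutive.toPerm X.inv X.inv_inv) (by simp) fun e _ => ?_
    change _ = if X.tgt e = a ∧ X.src (X.inv (X.inv e)) = b then ψ (X.inv (X.inv e)) else 0
    simp only [X.inv_inv, and_comm]
  simp only [weightedLaplacian, Matrix.transpose_add, Matrix.transpose_sub, Matrix.transpose_smul,
    Matrix.transpose_one, h, degreeMatrix, Matrix.diagonal_transpose]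

/-- The determinant of the Laplacian with `u` an indeterminate. -/
noncomputable def RegularCovering.genericDet : ℤ[X][T;T⁻¹] :=
  (X.weightedLaplacian (fun x => (T (p.shift s hs x) : ℤ[X][T;T⁻¹])) (C Polynomial.X)).det

/-- Transposing reverses all darts, which negates their shifts, and leaves the determinant
unchanged. -/
theorem RegularCovering.invert_genericDet : invert (p.genericDet s hs) = p.genericDet s hs := by
  have h := det_map_weightedLaplacian (X := X)
    (invert (R := ℤ[X])).toAlgHom.toRingHom
    (fun x => (T (p.shift s hs x))) (C Polynomial.X)
  change invert (p.genericDet s hs) = _ at h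
  rw [h, genericDet, ← Matrix.det_transpose, transpose_weightedLaplacian]
  simp [p.shift_inv]

/-- Specialization of `u` in Laurent polynomials. -/
noncomputable def specializeLaurent (u : ℂ) : ℤ[X][T;T⁻¹] →+* ℂ[T;T⁻¹] :=
  LaurentPolynomial.eval₂ ((C : ℂ →+* ℂ[T;T⁻¹]).comp
    (Polynomial.eval₂RingHom (Int.castRingHom ℂ) u)) (isUnit_T 1).unit

theorem specializeLaurent_T (u : ℂ) (n : ℤ) : specializeLaurent u (T n) = T n := by
  have h : ∀ n : ℕ, (((isUnit_T (R := ℂ) 1).unit ^ n : (ℂ[T;T⁻¹])ˣ) : ℂ[T;T⁻¹]) = T n := by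
    intro n
    rw [Units.val_pow_eq_pow_val, IsUnit.unit_spec, T_pow, mul_one]
  rw [specializeLaurent, eval₂_T]
  obtain ⟨n, rfl | rfl⟩ := n.eq_nat_or_neg
  · rw [zpow_natCast, h]
  · rw [zpow_neg, zpow_natCast, Units.inv_eq_of_mul_eq_one_right]
    rw [h, ← T_add, add_neg_cancel, T_zero]

theorem specializeLaurent_C (u : ℂ) (q : ℤ[X]) :
    specializeLaurent u (C q) = C (Polynomial.eval₂ (Int.castRingHom ℂ) u q) := by
  rw [specializeLaurent, eval₂_C]
  rfl

include p hs in
theorem RegularCovering.specializeLaurent_genericDet (u : ℂ) :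
    specializeLaurent u (p.genericDet s hs) = (Y.laplacian s u).det := by
  rw [genericDet, det_map_weightedLaplacian, p.laplacian_eq s hs]
  simp only [specializeLaurent_T, specializeLaurent_C, Polynomial.eval₂_X]

include p hs in
theorem RegularCovering.exists_isDetPolynomial : ∃ P : ℤ[X][X], Y.IsDetPolynomial s P := by
  obtain ⟨q, hq⟩ := mem_range_of_invert_eq (p.invert_genericDet s hs)
  -- The symmetric expression is a polynomial in t + t⁻¹, while P is evaluated at half of that.
  refine ⟨q.comp (2 * Polynomial.X), fun u => ?_⟩
  rw [← p.specializeLaurent_genericDet s hs, ← hq]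
  set φ := Polynomial.eval₂RingHom (Int.castRingHom ℂ) u
  have h1 : specialize (q.comp (2 * Polynomial.X)) u = (q.map φ).comp (2 * Polynomial.X) := by
    rw [specialize, Polynomial.map_comp]
    simp [φ]
  have h2 : (C (1 / 2 : ℂ) * 2 : ℂ[T;T⁻¹]) = 1 := by
    rw [← map_ofNat (C : ℂ →+* ℂ[T;T⁻¹]) 2, ← map_mul]
    norm_num
  rw [h1, Polynomial.aeval_comp]
  have h3 : Polynomial.aeval (C (1 / 2 : ℂ) * (T 1 + T (-1)) : ℂ[T;T⁻¹]) (2 * Polynomial.X : ℂ[X]) =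
      (T 1 + T (-1) : ℂ[T;T⁻¹]) := by
    simp only [map_mul, map_ofNat, Polynomial.aeval_X]
    linear_combination (T 1 + T (-1)) * h2
  rw [h3]
  change specializeLaurent u (Polynomial.aeval _ q) = _
  rw [Polynomial.aeval_def, Polynomial.hom_eval₂, Polynomial.aeval_def, Polynomial.eval₂_map,
    map_add, specializeLaurent_T, specializeLaurent_T]
  congr 1
  refine RingHom.ext fun a => ?_
  exact specializeLaurent_C u a

include p hs in
/-- Evaluation of the determinant at a nonzero complex number. -/
theorem RegularCovering.eval_isDetPolynomial {P : ℤ[X][X]} (hP : Y.IsDetPolynomial s P)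
    (u : ℂ) {z : ℂ} (hz : z ≠ 0) :
    (X.weightedLaplacian (fun x => z ^ p.shift s hs x) u).det =
      (specialize P u).eval ((z + z⁻¹) / 2) := by
  let ev : ℂ[T;T⁻¹] →+* ℂ := LaurentPolynomial.eval₂ (RingHom.id ℂ) (Units.mk0 z hz)
  have hT : ∀ n : ℤ, ev (T n) = z ^ n := fun n => by simp [ev, eval₂_T]
  have hC : ∀ a : ℂ, ev (C a) = a := fun a => by simp [ev]
  have h := congrArg ev (hP u)
  rw [p.laplacian_eq s hs, det_map_weightedLaplacian] at h
  simp only [hT, hC] at h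
  rw [h, Polynomial.aeval_def, Polynomial.hom_eval₂, map_mul, map_add, hT, hT, hC]
  have h1 : ev.comp (algebraMap ℂ ℂ[T;T⁻¹]) = RingHom.id ℂ := RingHom.ext hC
  rw [h1, Polynomial.eval₂_id]
  congr 1
  rw [zpow_one, zpow_neg_one]
  ring

/-- Each coefficient is a polynomial in u, determined by its complex values. -/
theorem specialize_injective {P P' : ℤ[X][X]} (h : ∀ u, specialize P u = specialize P' u) :
    P = P' := by
  ext k : 1
  refine Polynomial.map_injective (Int.castRingHom ℂ) Int.cast_injective
    (Polynomial.funext fun u => ?_)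
  have := congrArg (fun q => q.coeff k) (h u)
  simpa [specialize, Polynomial.eval_map] using this

include p hs in
theorem RegularCovering.existsUnique_isDetPolynomial :
    ∃! P : ℤ[X][X], Y.IsDetPolynomial s P := by
  obtain ⟨P, hP⟩ := p.exists_isDetPolynomial s hs
  refine ⟨P, hP, fun P' hP' => specialize_injective fun u => Polynomial.funext fun x => ?_⟩
  -- Every complex number is (z + z⁻¹)/2 for some z ≠ 0, so the determinants fix all values of P_u.
  obtain ⟨z, hz, rfl⟩ := exists_add_inv_div_two x
  rw [← p.eval_isDetPolynomial s hs hP' u hz, p.eval_isDetPolynomial s hs hP u hz]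

end

end SerreGraph

/-! ### Fourier analysis over the unit circle of characters. -/

namespace SerreGraph

open LaurentPolynomial

variable {X Y : SerreGraph} [Fintype X.V] [DecidableEq X.V] [Fintype X.Dart]
  [MulAction (Multiplicative ℤ) Y.V] [MulAction (Multiplicative ℤ) Y.Dart]
  [IsGraphAction (Multiplicative ℤ) Y] (p : RegularCovering (Multiplicative ℤ) Y X)
  (s : X.V → Y.V) (hs : ∀ a, p.onV (s a) = a)

/-- The total monodromy of a sequence of darts as an integer. -/
noncomputable def RegularCovering.totalShift (l : List X.Dart) : ℤ :=
  Multiplicative.toAdd (l.map (p.monodromy s hs)).prod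

theorem RegularCovering.prod_zpow_shift {z : ℂ} (hz : z ≠ 0) (l : List X.Dart) :
    (l.map fun x => z ^ p.shift s hs x).prod = z ^ p.totalShift s hs l := by
  induction l with
  | nil => simp [totalShift]
  | cons x l ih =>
    rw [List.map_cons, List.prod_cons, ih, ← zpow_add₀ hz]
    simp [totalShift, shift]

/-- Trivial monodromy is total shift zero: the words wanted are those contributing to the constant
term in z. -/
theorem RegularCovering.tsum_words (f : List X.Dart → ℂ) :
    ∑' l : p.words s hs, f l.1 =
      ∑' l : X.closedWords, if p.totalShift s hs l.1 = 0 then f l.1 else 0 := by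
  classical
  rw [tsum_subtype (p.words s hs) f,
    tsum_subtype X.closedWords (fun l => if p.totalShift s hs l = 0 then f l else 0)]
  refine tsum_congr fun l => ?_
  have h : l ∈ p.words s hs ↔ l ∈ X.closedWords ∧ p.totalShift s hs l = 0 := by
    simp only [RegularCovering.words, closedWords, Set.mem_ofPred_eq, totalShift, toAdd_eq_zero,
      and_assoc]
  simp only [Set.indicator_apply, h]
  by_cases h1 : l ∈ X.closedWords <;> simp [h1]

include p hs in
theorem RegularCovering.exp_words_eq {P : ℤ[X][X]} (hP : Y.IsDetPolynomial s P) {u : ℂ}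
    (hu : ‖u‖ < 1) (hd : Fintype.card X.Dart * ‖u‖ < 1) {n : ℕ} {α : ℂ} {r : Fin n → ℂ}
    (hr : specialize P u = Polynomial.C α * ∏ i, (Polynomial.C (r i) - Polynomial.X)) :
    Complex.exp (-∑' l : p.words s hs, u ^ l.1.length / (l.1.length : ℂ)) =
      (1 - u ^ 2) ^ (-X.eulerChar) * (α / 2 ^ n) *
        ∏ i, (r i + principalSqrt (r i + 1) * principalSqrt (r i - 1)) := by
  classical
  have hc0 : 1 - u ^ 2 ≠ 0 := by
    intro h
    have h1 : ‖u ^ 2‖ = 1 := by rw [← sub_eq_zero.1 h, norm_one]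
    rw [norm_pow] at h1
    exact absurd h1 (pow_lt_one₀ (norm_nonneg _) hu two_ne_zero).ne
  set w : Fin n → ℂ := fun i => r i + principalSqrt (r i + 1) * principalSqrt (r i - 1)
  have hpow : (1 - u ^ 2) ^ (-X.eulerChar) * (1 - u ^ 2) ^ Fintype.card X.V =
      (1 - u ^ 2) ^ X.edges.ncard := by
    rw [← zpow_natCast (1 - u ^ 2) (Fintype.card X.V), ← zpow_natCast (1 - u ^ 2) X.edges.ncard,
      ← zpow_add₀ hc0, eulerChar, Nat.card_eq_fintype_card]
    congr 1
    ring
  have heval : ∀ x : ℂ, (specialize P u).eval x = α * ∏ i, (r i - x) := fun x => by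
    rw [hr]
    simp [Polynomial.eval_prod]
  -- The weights z^shift have norm 1, as convergence requires, and are inverse on opposite darts, as
  -- Ihara–Bass requires.
  have hexp : ∀ z : ℂ, ‖z‖ = 1 →
      Summable (fun l : X.closedWords =>
        ‖u ^ l.1.length / (l.1.length : ℂ) * z ^ p.totalShift s hs l.1‖) ∧
      Complex.exp (-∑' l : X.closedWords,
        u ^ l.1.length / (l.1.length : ℂ) * z ^ p.totalShift s hs l.1) =
      (1 - u ^ 2) ^ (-X.eulerChar) * (α * ∏ i, (r i - (z + z⁻¹) / 2)) := by
    intro z hz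
    have hz0 : z ≠ 0 := by
      rintro rfl
      simp at hz
    have h1 := X.exp_neg_tsum_closedWords (fun x => z ^ p.shift s hs x)
      (fun x => by rw [norm_zpow, hz, one_zpow]) hd
    simp only [p.prod_zpow_shift s hs hz0] at h1
    refine ⟨h1.1, h1.2.trans ?_⟩
    have h2 := X.det_one_sub_edgeMatrix (ψ := fun x => z ^ p.shift s hs x) (fun x => by
      rw [p.shift_inv, ← zpow_add₀ hz0, add_neg_cancel, zpow_zero]) hc0
    have h3 := p.eval_isDetPolynomial s hs hP u hz0
    rw [weightedLaplacian] at h3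
    rw [h3, ← hpow, heval] at h2
    refine mul_right_cancel₀ (pow_ne_zero (Fintype.card X.V) hc0) (h2.trans ?_)
    ring
  -- Such a root would make the exponential in `hexp` vanish.
  have hr' : ∀ i, ∀ z : ℂ, ‖z‖ = 1 → r i ≠ (z + z⁻¹) / 2 := by
    intro i z hz h
    have h1 := (hexp z hz).2
    rw [Finset.prod_eq_zero (Finset.mem_univ i) (sub_eq_zero.2 h), mul_zero, mul_zero] at h1
    exact Complex.exp_ne_zero _ h1
  have hw : ∀ i, 1 < ‖w i‖ := fun i => one_lt_norm_joukowski_inverse (hr' i)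
  have hsum := (hexp 1 norm_one).1
  simp only [one_zpow, mul_one] at hsum
  have key := eq_exp_of_factorization
    (c := fun l : X.closedWords => -(u ^ l.1.length / (l.1.length : ℂ)))
    (by simpa only [norm_neg] using hsum) (fun l => p.totalShift s hs l.1) hw
    (C := (1 - u ^ 2) ^ (-X.eulerChar) * (α / 2 ^ n) * ∏ i, w i) (fun z hz => by
      have hz0 : z ≠ 0 := by
        rintro rfl
        simp at hz
      have h1 := (hexp z hz).2
      simp only [neg_mul, tsum_neg]
      rw [h1]
      -- Factorwise, from w + w⁻¹ = 2r: r - (z + z⁻¹)/2 = (w/2)(1 - z/w)(1 - z⁻¹/w).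
      have h2 : ∏ i, (r i - (z + z⁻¹) / 2) =
          (∏ i, w i) * (∏ i, (1 - z / w i)) * (∏ i, (1 - z⁻¹ / w i)) / 2 ^ n := by
        rw [eq_div_iff (by simp), ← Finset.prod_mul_distrib, ← Finset.prod_mul_distrib]
        have h3 : (2 : ℂ) ^ n = ∏ _i : Fin n, 2 := by simp
        rw [h3, ← Finset.prod_mul_distrib]
        refine Finset.prod_congr rfl fun i _ => ?_
        obtain ⟨h4, h5, -⟩ := joukowski_inverse (r i)
        change w i ≠ 0 at h4
        change w i + (w i)⁻¹ = 2 * r i at h5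
        have h6 : w i * (w i)⁻¹ = 1 := mul_inv_cancel₀ h4
        have h7 : z * z⁻¹ = 1 := mul_inv_cancel₀ hz0
        rw [div_eq_mul_inv z, div_eq_mul_inv z⁻¹]
        linear_combination -h5 + (z + z⁻¹ - (w i)⁻¹ * z * z⁻¹) * h6 - (w i)⁻¹ * h7
      rw [h2]
      ring)
  rw [key, ← tsum_neg, p.tsum_words s hs (fun l => -(u ^ l.length / (l.length : ℂ)))]

end SerreGraph

/-! ### Roots, leading coefficient and conclusion. -/

/-- The roots are finite in number; 0 itself may be one, whence the punctured disc. -/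
theorem Polynomial.exists_forall_eval_ne_zero {q : ℂ[X]} (hq : q ≠ 0) :
    ∃ R : ℝ, 0 < R ∧ ∀ u : ℂ, 0 < ‖u‖ → ‖u‖ < R → q.eval u ≠ 0 := by
  have h1 : ((q.roots.toFinset.erase 0 : Finset ℂ) : Set ℂ)ᶜ ∈ nhds (0 : ℂ) :=
    (Finset.finite_toSet _).isClosed.isOpen_compl.mem_nhds (by simp)
  obtain ⟨R, hR, h2⟩ := Metric.mem_nhds_iff.1 h1
  refine ⟨R, hR, fun u hu0 hu h => ?_⟩
  refine h2 (mem_ball_zero_iff.2 hu) ?_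
  have : u ≠ 0 := norm_pos_iff.1 hu0
  simp [this, hq, h]

theorem Polynomial.exists_eq_C_mul_prod_sub {q : ℂ[X]} {n : ℕ} (hn : q.natDegree = n) :
    ∃ r : Fin n → ℂ, q = C ((-1) ^ n * q.leadingCoeff) * ∏ i, (C (r i) - X) := by
  have hs := IsAlgClosed.splits q
  have hcard : q.roots.toList.length = n := by
    rw [Multiset.length_toList, ← hs.natDegree_eq_card_roots, hn]
  refine ⟨fun i => q.roots.toList.get (i.cast hcard.symm), ?_⟩
  have h1 : ∏ i : Fin n, (X - C (q.roots.toList.get (i.cast hcard.symm))) =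
      (q.roots.map fun a => X - C a).prod := by
    conv_rhs => rw [← Multiset.coe_toList q.roots]
    subst hcard
    rw [Multiset.map_coe, Multiset.prod_coe, ← List.prod_ofFn]
    congr 1
    refine List.ext_getElem (by simp) fun i h h' => by simp
  have h2 : ∏ i : Fin n, (C (q.roots.toList.get (i.cast hcard.symm)) - X) =
      C ((-1) ^ n) * ∏ i : Fin n, (X - C (q.roots.toList.get (i.cast hcard.symm))) := by
    have h3 : (C ((-1) ^ n) : ℂ[X]) = ∏ _i : Fin n, (-1) := by simp
    rw [h3, ← Finset.prod_mul_distrib]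
    exact Finset.prod_congr rfl fun i _ => by ring
  rw [h2, h1, ← mul_assoc, ← C_mul]
  conv_lhs => rw [hs.eq_prod_roots]
  congr 2
  rw [mul_right_comm, ← mul_pow]
  norm_num

/-- The coefficient is taken at the degree of `P`, which the specialization attains only where α
does not vanish. -/
theorem aeval_signedLeadingCoeff (P : ℤ[X][X]) (u : ℂ) :
    Polynomial.aeval u (signedLeadingCoeff P) =
      (-1) ^ P.natDegree * (specialize P u).coeff P.natDegree := by
  rw [signedLeadingCoeff, map_mul, map_pow, map_neg, map_one, specialize, Polynomial.coeff_map]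
  rfl

theorem theorem2p2 (X Y : SerreGraph) [Fintype X.V] [DecidableEq X.V] [Finite X.Dart]
    [MulAction (Multiplicative ℤ) Y.V] [MulAction (Multiplicative ℤ) Y.Dart]
    [SerreGraph.IsGraphAction (Multiplicative ℤ) Y]
    (p : SerreGraph.RegularCovering (Multiplicative ℤ) Y X)
    (s : X.V → Y.V) (hs : ∀ a, p.onV (s a) = a) :
    (∃! P : ℤ[X][X], Y.IsDetPolynomial s P) ∧
    ∀ P : ℤ[X][X], Y.IsDetPolynomial s P →
      ∃ R : ℝ, 0 < R ∧ ∀ u : ℂ, 0 < ‖u‖ → ‖u‖ < R →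
        Multipliable (SerreGraph.eulerFactor (Multiplicative ℤ) Y u) ∧
        Polynomial.aeval u (signedLeadingCoeff P) ≠ 0 ∧
        (∃ r : Fin P.natDegree → ℂ,
          specialize P u = Polynomial.C (Polynomial.aeval u (signedLeadingCoeff P)) *
            ∏ i, (Polynomial.C (r i) - Polynomial.X)) ∧
        ∀ r : Fin P.natDegree → ℂ,
          specialize P u = Polynomial.C (Polynomial.aeval u (signedLeadingCoeff P)) *
            ∏ i, (Polynomial.C (r i) - Polynomial.X) →
          (SerreGraph.l2Zeta (Multiplicative ℤ) Y u)⁻¹ =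
            (1 - u ^ 2) ^ (-X.eulerChar) *
              (Polynomial.aeval u (signedLeadingCoeff P) / 2 ^ P.natDegree) *
              ∏ i, (r i + principalSqrt (r i + 1) * principalSqrt (r i - 1)) := by
  have := Fintype.ofFinite X.Dart
  refine ⟨p.existsUnique_isDetPolynomial s hs, fun P hP => ?_⟩
  -- At u = 0 the Laplacian is the identity, of determinant 1.
  have hP0 : P ≠ 0 := by
    rintro rfl
    have h := p.eval_isDetPolynomial s hs hP 0 one_ne_zero
    simp [specialize, SerreGraph.weightedLaplacian] at h
  have hq0 : P.leadingCoeff.map (Int.castRingHom ℂ) ≠ 0 :=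
    (Polynomial.map_ne_zero_iff Int.cast_injective).2 (Polynomial.leadingCoeff_ne_zero.2 hP0)
  obtain ⟨R, hR, hroot⟩ := Polynomial.exists_forall_eval_ne_zero hq0
  -- The first bound avoids the zeros of α; the second yields both ‖u‖ < 1 and card · ‖u‖ < 1.
  refine ⟨min R (1 / (Fintype.card X.Dart + 1)), by positivity, fun u hu0 hu => ?_⟩
  have hu1 := (lt_min_iff.1 hu).2
  rw [lt_div_iff₀ (by positivity)] at hu1
  have hnn := norm_nonneg u
  have hcard : (0 : ℝ) ≤ Fintype.card X.Dart := by positivity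
  have hlt : ‖u‖ < 1 := by nlinarith
  have hd : Fintype.card X.Dart * ‖u‖ < 1 := by nlinarith
  have hcoeff : (specialize P u).coeff P.natDegree ≠ 0 := by
    have := hroot u hu0 (lt_min_iff.1 hu).1
    rw [Polynomial.eval_map] at this
    rw [specialize, Polynomial.coeff_map]
    exact this
  have hdeg : (specialize P u).natDegree = P.natDegree :=
    le_antisymm (Polynomial.natDegree_map_le) (Polynomial.le_natDegree_of_ne_zero hcoeff)
  have hprod := p.hasProd_eulerFactor s hs hlt hd
  refine ⟨hprod.multipliable, ?_, ?_, fun r hr => ?_⟩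
  · rw [aeval_signedLeadingCoeff]
    exact mul_ne_zero (pow_ne_zero _ (by norm_num)) hcoeff
  · obtain ⟨r, hr⟩ := Polynomial.exists_eq_C_mul_prod_sub hdeg
    refine ⟨r, ?_⟩
    have hlc : (specialize P u).coeff P.natDegree = (specialize P u).leadingCoeff := by
      rw [← hdeg, Polynomial.coeff_natDegree]
    rwa [aeval_signedLeadingCoeff, hlc]
  · rw [SerreGraph.l2Zeta, inv_inv, hprod.tprod_eq]
    exact p.exp_words_eq s hs hP hlt hd hr
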